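/- **Theorem (I/O complexity of constructing optimal binary search trees without recomputation).** *Algorithm and its CDAGs.* Given $p_1,\dots,p_{n-1}$ and $q_1,\dots,q_n$ (search probabilities for $n-1$ distinct sorted keys and for the $n$ gaps), the dynamic program $\mathcal A_{BST}$ sets $S(i,i)=C(i,i)=q_i$ and, for $1\le i<j\le n$, $$C(i,j)=C(i,j-1)+p_{j-1}+q_j,\qquad S(i,j)=\min_{i\le k<j}\bigl(S(i,k)+S(k+1,j)+C(i,j)\bigr),$$ and outputs $S(1,n)$. The minimum for each $(i,j)$ is taken along some binary tree $T_{i,j}$ with $j-i$ leaves, one for each $k\in\{i,\dots,j-1\}$; the choice $T=(T_{i,j})_{1\le i<j\le n}$ is an implementation choice. Let $G_{BST}(n,T)$ be the computational DAG whose vertices are the inputs $p_l,q_l$, the values $C(i,j)$ for $i<j$ (operands $C(i,j-1),p_{j-1},q_j$), and the vertices of the trees $T_{i,j}$: the leaf $k$ of $T_{i,j}$ has operands $S(i,k),S(k+1,j),C(i,j)$, an internal vertex has its two children as operands, and the root is $S(i,j)$. *Machine.* There are a cache of $M$ words, initially empty, and an unbounded, linearly addressed slow memory that initially contains $p_1,\dots,p_{n-1},q_1,\dots,q_n$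 in consecutive cells. Each value takes one word. A vertex can be computed only when all its operands are in the cache, and its result is placed in the cache. One I/O operation (read or write) moves at most $B$ words between the cache and consecutive cells of slow memory. At the end $S(1,n)$ must be in slow memory. $IO_{G}(n,M,B)$ denotes the minimum number of I/O operations over all schedules that evaluate $G$ in which no vertex is computed more than once. *Statement.* There are constants $c,c_1,c_2>0$ such that: 1. for all integers $n\ge 0$, $B\ge 1$, $M\ge 4$ with $M<cn^2$, and for every choice $T$ of the trees, $$IO_{G_{BST}(n,T)}(n,M,B)\ \ge\ c_1\,\frac{n^3}{B\sqrt M};$$ 2. for every $n$ there is a choice $T^{(n)}$ of the trees (not depending on $M$ and $B$) such that, for all integers $M\ge 4$ and $1\le B\le M$ with $M<cn^2$, $$IO_{G_{BST}(n,T^{(n)})}(n,M,B)\ \le\ c_2\,\frac{n^3}{B\sqrt M}.$$ In particular, for $4\le M<cn^2$ and $1\le B\le M$, the I/O complexity of $\mathcal A_{BST}$ without recomputation is $\Theta\!\left(\frac{n^3}{B\sqrt M}\right)$. -/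

import Mathlib

open scoped ENNReal

/-! ### Computational DAGs and the two-level memory model -/

/-- A computational directed acyclic graph. `pre v` is the set of predecessors (operands)
of the vertex `v`. -/
structure CDAG (V : Type) where
  vertices : Set V
  pre : V → Finset V
  pre_mem : ∀ v ∈ vertices, ∀ u ∈ pre v, u ∈ vertices
  acyclic : WellFounded fun u v => v ∈ vertices ∧ u ∈ pre v

/-- The output vertices: those with no successor. -/
def CDAG.outputs {V : Type} (G : CDAG V) : Set V :=
  {v | v ∈ G.vertices ∧ ∀ w ∈ G.vertices, v ∉ G.pre w}

/-- A state of the memory hierarchy: the values held in the cache, and the slow memory, an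
unbounded array of cells indexed by `ℕ`, each holding one value or nothing. Moving words
around inside the cache is free, so the cache is recorded as a set of values. -/
structure MemState (V : Type) where
  cache : Finset V
  slow : ℕ → Option V

/-- The operations of the machine.
* `compute v`: evaluate the vertex `v`, leaving the result in the cache;
* `discard v`: drop the value of `v` from the cache;
* `read a k`: copy the `k` consecutive slow memory cells `a, …, a + k - 1` into the cache;
* `write a l`: copy the values of the list `l` from the cache into the `l.length` consecutive
  slow memory cells starting at `a`, overwriting them. -/
inductive MemOp (V : Type) where
  | compute (v : V)
  | discard (v : V)
  | read (a k : ℕ)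
  | write (a : ℕ) (l : List V)

/-- Only `read` and `write` are I/O operations, each of cost one. -/
def MemOp.ioCost {V : Type} : MemOp V → ℕ
  | .compute _ => 0
  | .discard _ => 0
  | .read _ _ => 1
  | .write _ _ => 1

/-- The effect of an operation. -/
def MemOp.apply {V : Type} [DecidableEq V] (s : MemState V) : MemOp V → MemState V
  | .compute v => ⟨insert v s.cache, s.slow⟩
  | .discard v => ⟨s.cache.erase v, s.slow⟩
  | .read a k => ⟨s.cache ∪ (Finset.range k).biUnion fun t => (s.slow (a + t)).toFinset, s.slow⟩
  | .write a l =>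
      ⟨s.cache, fun x => if a ≤ x ∧ x < a + l.length then l[x - a]? else s.slow x⟩

/-- When an operation may be executed in state `s`, apart from the bound on the cache size.
A vertex is computed only if it is not an input and all its operands are in the cache;
an I/O operation moves at most `B` words. -/
def MemOp.Legal {V : Type} (G : CDAG V) (B : ℕ) (s : MemState V) : MemOp V → Prop
  | .compute v => v ∈ G.vertices ∧ (G.pre v).Nonempty ∧ G.pre v ⊆ s.cache
  | .discard _ => True
  | .read _ k => k ≤ B
  | .write _ l => l.length ≤ B ∧ ∀ v ∈ l, v ∈ s.cache

/-- The state reached from `s` by executing a list of operations. -/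
def runOps {V : Type} [DecidableEq V] (s : MemState V) (ops : List (MemOp V)) : MemState V :=
  ops.foldl MemOp.apply s

/-- Every operation of the list is legal when it is executed, and the cache never holds more
than `M` words. -/
def LegalRun {V : Type} [DecidableEq V] (G : CDAG V) (M B : ℕ) :
    MemState V → List (MemOp V) → Prop
  | _, [] => True
  | s, o :: os =>
      o.Legal G B s ∧ (o.apply s).cache.card ≤ M ∧ LegalRun G M B (o.apply s) os

/-- The vertices evaluated by a list of operations, with repetitions. -/
def computedList {V : Type} : List (MemOp V) → List V
  | [] => []
  | .compute v :: os => v :: computedList os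
  | _ :: os => computedList os

/-- The number of I/O operations of a list of operations. -/
def totalIO {V : Type} (ops : List (MemOp V)) : ℕ :=
  (ops.map MemOp.ioCost).sum

/-- `ops` is a computational schedule without recomputation for `G`: it starts with an empty
cache and with slow memory content `init` (where the input lies), it is legal for cache size `M`
and block size `B`, it evaluates no vertex more than once, and it ends with every
output value in slow memory. -/
def IsNRSchedule {V : Type} [DecidableEq V] (G : CDAG V) (init : ℕ → Option V) (M B : ℕ)
    (ops : List (MemOp V)) : Prop :=
  LegalRun G M B ⟨∅, init⟩ ops ∧ (computedList ops).Nodup ∧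
    ∀ v ∈ G.outputs, ∃ a, (runOps ⟨∅, init⟩ ops).slow a = some v

/-- The I/O complexity without recomputation: the minimum number of I/O operations over all
schedules without recomputation (`⊤` if there is none). -/
noncomputable def ioComplexityNR {V : Type} [DecidableEq V] (G : CDAG V) (init : ℕ → Option V)
    (M B : ℕ) : ℕ∞ :=
  ⨅ (ops : List (MemOp V)) (_ : IsNRSchedule G init M B ops), (totalIO ops : ℕ∞)

/-! ### The CDAGs of the optimal binary search tree algorithm -/

/-- Full binary trees with leaves labelled by natural numbers: `leaf k` is the candidate with
split position `k`, `node l r` the minimum of the values of `l` and `r`. -/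
inductive AggTree where
  | leaf (k : ℕ)
  | node (l r : AggTree)
  deriving DecidableEq

/-- The leaf labels from left to right. -/
def AggTree.leaves : AggTree → List ℕ
  | .leaf k => [k]
  | .node l r => l.leaves ++ r.leaves

/-- `s.IsSubtree t`: `s` is the subtree of `t` hanging from one of the vertices of `t`. -/
def AggTree.IsSubtree (s : AggTree) : AggTree → Prop
  | .leaf k => s = .leaf k
  | .node l r => s = .node l r ∨ s.IsSubtree l ∨ s.IsSubtree r

/-- The number of vertices of the tree. -/
def AggTree.size : AggTree → ℕ
  | .leaf _ => 1
  | .node l r => l.size + r.size + 1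

/-- A choice, for every subproblem `(i, j)` with `1 ≤ i < j ≤ n`, of a binary tree along which
the minimum over the split positions `k = i, …, j - 1` is taken. -/
structure AggTrees (n : ℕ) where
  tree : ℕ → ℕ → AggTree
  leaves_perm : ∀ i j, 1 ≤ i → i < j → j ≤ n → (tree i j).leaves.Perm (List.Ico i j)

/-- Labels of the vertices: the inputs `p l`, `q l`; the cumulative weight `C(i, j)`, `i < j`; and
`agg i j t`, the minimum of the candidates of `S(i, j)` whose split positions are the
leaves of `t`. -/
inductive BSTVertex where
  | p (l : ℕ)
  | q (l : ℕ)
  | cum (i j : ℕ)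
  | agg (i j : ℕ) (t : AggTree)
  deriving DecidableEq

/-- The vertex holding `C(i, j)`; in particular `C(i, i) = q i`. -/
def cumVertex (i j : ℕ) : BSTVertex :=
  if i = j then .q i else .cum i j

/-- The vertex holding `S(i, j)`; in particular `S(i, i) = q i`. -/
def rootVertex {n : ℕ} (T : AggTrees n) (i j : ℕ) : BSTVertex :=
  if i = j then .q i else .agg i j (T.tree i j)

/-- The operands of each operation:
`C(i, j) = C(i, j - 1) + p (j - 1) + q j`, the candidate `S(i, k) + S(k + 1, j) + C(i, j)`, and
binary minima. -/
def bstPre {n : ℕ} (T : AggTrees n) : BSTVertex → Finset BSTVertex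
  | .p _ => ∅
  | .q _ => ∅
  | .cum i j => {cumVertex i (j - 1), .p (j - 1), .q j}
  | .agg i j (.leaf k) => {rootVertex T i k, rootVertex T (k + 1) j, cumVertex i j}
  | .agg i j (.node l r) => {.agg i j l, .agg i j r}

/-- Which labels are vertices for the instance with `n - 1` keys. -/
def IsBSTVertex {n : ℕ} (T : AggTrees n) : BSTVertex → Prop
  | .p l => 1 ≤ l ∧ l < n
  | .q l => 1 ≤ l ∧ l ≤ n
  | .cum i j => 1 ≤ i ∧ i < j ∧ j ≤ n
  | .agg i j t => 1 ≤ i ∧ i < j ∧ j ≤ n ∧ t.IsSubtree (T.tree i j)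

theorem AggTree.isSubtree_refl (t : AggTree) : t.IsSubtree t := by
  cases t <;> simp [AggTree.IsSubtree]

theorem AggTree.isSubtree_of_node {l r : AggTree} (t : AggTree)
    (h : (AggTree.node l r).IsSubtree t) : l.IsSubtree t ∧ r.IsSubtree t := by
  induction t with
  | leaf k => simp [AggTree.IsSubtree] at h
  | node a b iha ihb =>
    simp only [AggTree.IsSubtree] at h ⊢
    rcases h with h | h | h
    · injection h with h1 h2
      subst h1 h2
      exact ⟨Or.inr (Or.inl l.isSubtree_refl), Or.inr (Or.inr r.isSubtree_refl)⟩
    · exact ⟨Or.inr (Or.inl (iha h).1), Or.inr (Or.inl (iha h).2)⟩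
    · exact ⟨Or.inr (Or.inr (ihb h).1), Or.inr (Or.inr (ihb h).2)⟩

theorem AggTree.mem_leaves_of_isSubtree {k : ℕ} (t : AggTree)
    (h : (AggTree.leaf k).IsSubtree t) : k ∈ t.leaves := by
  induction t with
  | leaf m => simpa [AggTree.IsSubtree, AggTree.leaves] using h
  | node a b iha ihb =>
    simp only [AggTree.IsSubtree, AggTree.leaves, List.mem_append] at h ⊢
    rcases h with h | h | h
    · simp at h
    · exact Or.inl (iha h)
    · exact Or.inr (ihb h)

theorem split_mem_range {n : ℕ} (T : AggTrees n) {i j k : ℕ}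
    (h : IsBSTVertex T (.agg i j (.leaf k))) : i ≤ k ∧ k < j := by
  obtain ⟨h1, h2, h3, h4⟩ := h
  have := (T.leaves_perm i j h1 h2 h3).mem_iff.1 (AggTree.mem_leaves_of_isSubtree _ h4)
  simpa using this

theorem isBSTVertex_cumVertex {n : ℕ} (T : AggTrees n) {i j : ℕ}
    (h1 : 1 ≤ i) (h2 : i ≤ j) (h3 : j ≤ n) : IsBSTVertex T (cumVertex i j) := by
  unfold cumVertex
  split_ifs with h <;> simp only [IsBSTVertex] <;> omega

theorem isBSTVertex_rootVertex {n : ℕ} (T : AggTrees n) {i j : ℕ}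
    (h1 : 1 ≤ i) (h2 : i ≤ j) (h3 : j ≤ n) : IsBSTVertex T (rootVertex T i j) := by
  unfold rootVertex
  split_ifs with h
  · simp only [IsBSTVertex]; omega
  · exact ⟨h1, by omega, h3, AggTree.isSubtree_refl _⟩

theorem bstPre_mem {n : ℕ} (T : AggTrees n) (v : BSTVertex) (hv : IsBSTVertex T v)
    (u : BSTVertex) (hu : u ∈ bstPre T v) : IsBSTVertex T u := by
  match v with
  | .p l => simp [bstPre] at hu
  | .q l => simp [bstPre] at hu
  | .cum i j =>
    obtain ⟨h1, h2, h3⟩ := hv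
    simp only [bstPre, Finset.mem_insert, Finset.mem_singleton] at hu
    rcases hu with rfl | rfl | rfl
    · exact isBSTVertex_cumVertex T h1 (by omega) (by omega)
    · simp only [IsBSTVertex]; omega
    · simp only [IsBSTVertex]; omega
  | .agg i j (.leaf k) =>
    have hk := split_mem_range T hv
    obtain ⟨h1, h2, h3, h4⟩ := hv
    simp only [bstPre, Finset.mem_insert, Finset.mem_singleton] at hu
    rcases hu with rfl | rfl | rfl
    · exact isBSTVertex_rootVertex T h1 hk.1 (by omega)
    · exact isBSTVertex_rootVertex T (by omega) (by omega) h3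
    · exact isBSTVertex_cumVertex T h1 h2.le h3
  | .agg i j (.node l r) =>
    obtain ⟨h1, h2, h3, h4⟩ := hv
    simp only [bstPre, Finset.mem_insert, Finset.mem_singleton] at hu
    have h5 := AggTree.isSubtree_of_node _ h4
    rcases hu with rfl | rfl
    · exact ⟨h1, h2, h3, h5.1⟩
    · exact ⟨h1, h2, h3, h5.2⟩

/-- A rank that increases along the edges. -/
def bstRank : BSTVertex → ℕ ×ₗ ℕ
  | .p _ => toLex (0, 0)
  | .q _ => toLex (0, 0)
  | .cum i j => toLex (j - i, 0)
  | .agg i j t => toLex (j - i, t.size)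

theorem bstRank_cumVertex_lt (i j d e : ℕ) (h : j - i < d ∨ j - i = d ∧ 0 < e) :
    bstRank (cumVertex i j) < toLex (d, e) := by
  unfold cumVertex
  split_ifs with h0 <;> simp only [bstRank, Prod.Lex.toLex_lt_toLex] <;> omega

theorem bstRank_rootVertex_lt {n : ℕ} (T : AggTrees n) (i j d e : ℕ) (h : j - i < d) :
    bstRank (rootVertex T i j) < toLex (d, e) := by
  unfold rootVertex
  split_ifs with h0 <;> simp only [bstRank, Prod.Lex.toLex_lt_toLex] <;> omega

theorem bstRank_lt {n : ℕ} (T : AggTrees n) (v : BSTVertex) (hv : IsBSTVertex T v)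
    (u : BSTVertex) (hu : u ∈ bstPre T v) : bstRank u < bstRank v := by
  match v with
  | .p l => simp [bstPre] at hu
  | .q l => simp [bstPre] at hu
  | .cum i j =>
    obtain ⟨h1, h2, h3⟩ := hv
    simp only [bstPre, Finset.mem_insert, Finset.mem_singleton] at hu
    rcases hu with rfl | rfl | rfl
    · exact bstRank_cumVertex_lt _ _ _ _ (by omega)
    · simp only [bstRank, Prod.Lex.toLex_lt_toLex]; omega
    · simp only [bstRank, Prod.Lex.toLex_lt_toLex]; omega
  | .agg i j (.leaf k) =>
    have hk := split_mem_range T hv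
    obtain ⟨h1, h2, h3, h4⟩ := hv
    simp only [bstPre, Finset.mem_insert, Finset.mem_singleton] at hu
    rcases hu with rfl | rfl | rfl
    · exact bstRank_rootVertex_lt _ _ _ _ _ (by omega)
    · exact bstRank_rootVertex_lt _ _ _ _ _ (by omega)
    · exact bstRank_cumVertex_lt _ _ _ _ (Or.inr ⟨rfl, by simp [AggTree.size]⟩)
  | .agg i j (.node l r) =>
    simp only [bstPre, Finset.mem_insert, Finset.mem_singleton] at hu
    rcases hu with rfl | rfl <;> rw [bstRank, bstRank, Prod.Lex.toLex_lt_toLex] <;>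
      refine Or.inr ⟨rfl, ?_⟩ <;> simp only [AggTree.size] <;> omega

/-- The CDAG of the construction of an optimal binary search tree on `n - 1` keys in which the
minima are taken along the trees `T`. -/
def bstCDAG {n : ℕ} (T : AggTrees n) : CDAG BSTVertex where
  vertices := {v | IsBSTVertex T v}
  pre := bstPre T
  pre_mem := bstPre_mem T
  acyclic := Subrelation.wf (fun {u v} h => bstRank_lt T v h.1 u h.2)
    (InvImage.wf bstRank wellFounded_lt)

/-- The initial content of the slow memory: the array `p 1, …, p (n - 1)` followed by the array
`q 1, …, q n`, from address `0` on. -/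
def bstInput (n : ℕ) (a : ℕ) : Option BSTVertex :=
  if a < n - 1 then some (.p (a + 1))
  else if a < 2 * n - 1 then some (.q (a - (n - 1) + 1))
  else none

/-- The I/O complexity, without recomputation, of the optimal binary search tree CDAG given by
`T`, with cache size `M` and block size `B`. -/
noncomputable def bstIO {n : ℕ} (T : AggTrees n) (M B : ℕ) : ℕ∞ :=
  ioComplexityNR (bstCDAG T) (bstInput n) M B

/-! Lower bound. The unit of work is a split `(i, k, j)`, the candidate of S(i, j) with split
position k; a schedule evaluates of the order of n³ splits, each once. Cut it into segments of about
8·M^(3/2) splits. The set L of splits of a segment touches a set P of subproblems, namely its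
projections, and a Loomis–Whitney argument gives |L|² ≤ |P|³ (`card_sq_le_card_cube`). Some touched
subproblems have a value that is in the cache at an end of the segment or is moved during it; there
are at most 2M + B·IO of these. The others live entirely inside the segment: as nothing is
recomputed, all their splits and all splits using their solution are evaluated there
(`local_splits`). That makes n - 1 splits for each, so there are at most 3|L|/(n - 1) of them, which
is at most M because n > 100√M. If the segment moved fewer than M words, then |P| < 4M and |L|² <
64M³, contrary to the choice of |L|. So every full segment moves M words (`segment_moves`), and
there are of the order of n³/M^(3/2) segments. The shape of the trees is irrelevant.

Upper bound. With a = i - 1, split k of (a, j) combines (a, k) and (k, j), as in a matrix product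
over a triangle, and can be tiled with b × b tiles, b² of order M. For a tile (I, J), the partial
minima of all its pairs stay in the cache while the tiles (I, K) and (K, J) are read for each I < K
< J (`reach_tile_middle`); the splits in the blocks I and J, which depend on the tile itself, come
last (`reach_tile_final`). This costs O(n/b) tile transfers per tile, hence O((n/b)³·b²/B) in all.
The trees must allow this order for every M at once: left combs along `splitOrder` do, since for
each power of two b = 2^t the splits outside the end blocks form a prefix, arranged block by block
(`splitOrder_eq_append`). For M < 16 evaluating the vertices one at a time is good enough
(`bstIO_le_naive`).

The schedules are built with `Reach`, which abstracts a machine state to the exact cache, the tiles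
known to be stored, and a superset of the values already computed. -/

/-! ### Runs of the machine -/

section Runs

variable {V : Type} [DecidableEq V]

theorem runOps_append (s : MemState V) (o₁ o₂ : List (MemOp V)) :
    runOps s (o₁ ++ o₂) = runOps (runOps s o₁) o₂ := by
  simp [runOps]

theorem runOps_cons (s : MemState V) (o : MemOp V) (os : List (MemOp V)) :
    runOps s (o :: os) = runOps (o.apply s) os := rfl

theorem computedList_append {V : Type} (o₁ o₂ : List (MemOp V)) :
    computedList (o₁ ++ o₂) = computedList o₁ ++ computedList o₂ := by
  induction o₁ with
  | nil => rfl
  | cons o os ih => cases o <;> simp [computedList, ih]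

theorem totalIO_append {V : Type} (o₁ o₂ : List (MemOp V)) :
    totalIO (o₁ ++ o₂) = totalIO o₁ + totalIO o₂ := by
  simp [totalIO]

theorem legalRun_append (G : CDAG V) (M B : ℕ) (s : MemState V) (o₁ o₂ : List (MemOp V)) :
    LegalRun G M B s (o₁ ++ o₂) ↔ LegalRun G M B s o₁ ∧ LegalRun G M B (runOps s o₁) o₂ := by
  induction o₁ generalizing s with
  | nil => simp [LegalRun, runOps]
  | cons o os ih => simp [LegalRun, ih, runOps_cons, and_assoc]

theorem LegalRun.card_cache_le {G : CDAG V} {M B : ℕ} {s : MemState V} {ops : List (MemOp V)}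
    (h : LegalRun G M B s ops) (hs : s.cache.card ≤ M) : (runOps s ops).cache.card ≤ M := by
  induction ops generalizing s with
  | nil => exact hs
  | cons o os ih => exact ih h.2.2 h.2.1

/-- The values moved between the cache and the slow memory by an operation. -/
def MemOp.moved (s : MemState V) : MemOp V → Finset V
  | .compute _ => ∅
  | .discard _ => ∅
  | .read a k => (Finset.range k).biUnion fun t => (s.slow (a + t)).toFinset
  | .write _ l => l.toFinset

/-- The values moved between the cache and the slow memory by a list of operations. -/
def movedBy : MemState V → List (MemOp V) → Finset V
  | _, [] => ∅
  | s, o :: os => o.moved s ∪ movedBy (o.apply s) os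

theorem movedBy_append (s : MemState V) (o₁ o₂ : List (MemOp V)) :
    movedBy s (o₁ ++ o₂) = movedBy s o₁ ∪ movedBy (runOps s o₁) o₂ := by
  induction o₁ generalizing s with
  | nil => simp [movedBy, runOps]
  | cons o os ih => simp [movedBy, ih, runOps_cons, Finset.union_assoc]

theorem MemOp.card_moved_le {G : CDAG V} {B : ℕ} {s : MemState V} {o : MemOp V}
    (h : o.Legal G B s) : (o.moved s).card ≤ B * o.ioCost := by
  cases o with
  | compute v => simp [MemOp.moved]
  | discard v => simp [MemOp.moved]
  | read a k =>
    have h1 : k ≤ B := h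
    simp only [MemOp.moved, MemOp.ioCost, mul_one]
    refine (Finset.card_biUnion_le_card_mul _ _ 1 fun t _ => ?_).trans (by simpa using h1)
    cases s.slow (a + t) <;> simp
  | write a l =>
    simp only [MemOp.moved, MemOp.ioCost, mul_one]
    exact (List.toFinset_card_le l).trans h.1

theorem LegalRun.card_movedBy_le {G : CDAG V} {M B : ℕ} {s : MemState V} {ops : List (MemOp V)}
    (h : LegalRun G M B s ops) : (movedBy s ops).card ≤ B * totalIO ops := by
  induction ops generalizing s with
  | nil => simp [movedBy]
  | cons o os ih =>
    have h1 := MemOp.card_moved_le h.1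
    have h2 := ih h.2.2
    have h3 := Finset.card_union_le (o.moved s) (movedBy (o.apply s) os)
    simp only [movedBy, totalIO, List.map_cons, List.sum_cons, mul_add] at *
    omega

theorem mem_cache_runOps {s : MemState V} {ops : List (MemOp V)} {v : V}
    (h : v ∈ (runOps s ops).cache) : v ∈ s.cache ∨ v ∈ movedBy s ops ∨ v ∈ computedList ops := by
  induction ops generalizing s with
  | nil => exact Or.inl h
  | cons o os ih =>
    have h1 := ih (s := o.apply s) h
    cases o <;> simp only [MemOp.apply, movedBy, MemOp.moved, computedList, Finset.mem_insert,
      Finset.mem_union, Finset.mem_erase, List.mem_cons] at h1 ⊢ <;> tauto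

theorem slow_runOps {s : MemState V} {ops : List (MemOp V)} {v : V} {a : ℕ}
    (h : (runOps s ops).slow a = some v) : (∃ b, s.slow b = some v) ∨ v ∈ movedBy s ops := by
  induction ops generalizing s with
  | nil => exact Or.inl ⟨a, h⟩
  | cons o os ih =>
    rcases ih (s := o.apply s) h with ⟨b, hb⟩ | h1
    · cases o with
      | compute v => exact Or.inl ⟨b, hb⟩
      | discard v => exact Or.inl ⟨b, hb⟩
      | read a k => exact Or.inl ⟨b, hb⟩
      | write c l =>
        simp only [MemOp.apply] at hb
        split_ifs at hb
        · right
          simp only [movedBy, MemOp.moved, Finset.mem_union, List.mem_toFinset]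
          exact Or.inl (List.mem_of_getElem? hb)
        · exact Or.inl ⟨b, hb⟩
    · exact Or.inr (Finset.mem_union_right _ h1)

/-- The value `v` is somewhere in the memory hierarchy. -/
def MemState.Present (s : MemState V) (v : V) : Prop :=
  v ∈ s.cache ∨ ∃ a, s.slow a = some v

/-- Transfers only copy: a read takes values from slow memory and a legal write takes them from the
cache, so a new value can only come from a computation. -/
theorem LegalRun.present_of_present {G : CDAG V} {M B : ℕ} {s : MemState V}
    {ops : List (MemOp V)} (hl : LegalRun G M B s ops) {v : V} (h : (runOps s ops).Present v) :
    s.Present v ∨ v ∈ computedList ops := by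
  induction ops generalizing s with
  | nil => exact Or.inl h
  | cons o os ih =>
    rcases ih hl.2.2 h with h1 | h1
    · cases o with
      | compute w =>
        simp only [MemState.Present, MemOp.apply, Finset.mem_insert, computedList,
          List.mem_cons] at h1 ⊢
        tauto
      | discard w =>
        simp only [MemState.Present, MemOp.apply, Finset.mem_erase] at h1 ⊢
        tauto
      | read a k =>
        simp only [MemState.Present, MemOp.apply, Finset.mem_union, Finset.mem_biUnion,
          Option.mem_toFinset, Option.mem_def] at h1 ⊢
        rcases h1 with (h1 | ⟨t, _, h1⟩) | h1
        · exact Or.inl (Or.inl h1)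
        · exact Or.inl (Or.inr ⟨_, h1⟩)
        · exact Or.inl (Or.inr h1)
      | write a l =>
        left
        rcases h1 with h1 | ⟨b, hb⟩
        · exact Or.inl h1
        · simp only [MemOp.apply] at hb
          split_ifs at hb
          · exact Or.inl (hl.1.2 v (List.mem_of_getElem? hb))
          · exact Or.inr ⟨b, hb⟩
    · right
      cases o <;> simp [computedList, h1]

theorem exists_append_compute {V : Type} {ops : List (MemOp V)} {v : V}
    (h : v ∈ computedList ops) : ∃ o₁ o₂, ops = o₁ ++ .compute v :: o₂ := by
  induction ops with
  | nil => simp [computedList] at h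
  | cons o os ih =>
    have key : v ∈ computedList os → ∃ o₁ o₂, o :: os = o₁ ++ .compute v :: o₂ := fun h => by
      obtain ⟨o₁, o₂, rfl⟩ := ih h
      exact ⟨o :: o₁, o₂, rfl⟩
    cases o with
    | compute w =>
      rcases List.mem_cons.1 h with rfl | h
      · exact ⟨[], os, rfl⟩
      · exact key h
    | discard w => exact key h
    | read a k => exact key h
    | write a l => exact key h

theorem LegalRun.exists_pre_subset {G : CDAG V} {M B : ℕ} {s : MemState V}
    {ops : List (MemOp V)} (hl : LegalRun G M B s ops) {v : V} (h : v ∈ computedList ops) :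
    v ∈ G.vertices ∧ ∃ o₁ o₂, ops = o₁ ++ o₂ ∧ LegalRun G M B s o₁ ∧
      G.pre v ⊆ (runOps s o₁).cache := by
  obtain ⟨o₁, o₂, rfl⟩ := exists_append_compute h
  rw [legalRun_append] at hl
  exact ⟨hl.2.1.1, o₁, _, rfl, hl.1, hl.2.1.2.2⟩

theorem LegalRun.pre_mem {G : CDAG V} {M B : ℕ} {s : MemState V}
    {ops : List (MemOp V)} (hl : LegalRun G M B s ops) {u v : V} (h : v ∈ computedList ops)
    (hu : u ∈ G.pre v) : u ∈ s.cache ∨ u ∈ movedBy s ops ∨ u ∈ computedList ops := by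
  obtain ⟨_, o₁, o₂, rfl, _, h1⟩ := hl.exists_pre_subset h
  rw [movedBy_append, computedList_append, Finset.mem_union, List.mem_append]
  have := mem_cache_runOps (h1 hu)
  tauto

theorem LegalRun.pre_present {G : CDAG V} {M B : ℕ} {s : MemState V}
    {ops : List (MemOp V)} (hl : LegalRun G M B s ops) {u v : V} (h : v ∈ computedList ops)
    (hu : u ∈ G.pre v) : s.Present u ∨ u ∈ computedList ops := by
  obtain ⟨_, o₁, o₂, rfl, h2, h1⟩ := hl.exists_pre_subset h
  rw [computedList_append, List.mem_append]
  have := h2.present_of_present (Or.inl (h1 hu))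
  tauto

/-- Without recomputation, a value computed in the segment `o₂` of a schedule that is neither
moved during the segment nor kept in the cache at its end has all its uses in the segment. -/
theorem LegalRun.succ_mem_segment {G : CDAG V} {M B : ℕ} {s : MemState V}
    {o₁ o₂ o₃ : List (MemOp V)} (hl : LegalRun G M B s (o₁ ++ (o₂ ++ o₃)))
    (hn : (computedList (o₁ ++ (o₂ ++ o₃))).Nodup) {u v : V} (hs : ¬ s.Present u)
    (hu : u ∈ computedList o₂) (h1 : u ∉ (runOps (runOps s o₁) o₂).cache)
    (h2 : u ∉ movedBy (runOps s o₁) o₂) (hv : v ∈ computedList (o₁ ++ (o₂ ++ o₃)))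
    (huv : u ∈ G.pre v) : v ∈ computedList o₂ := by
  simp only [computedList_append, List.nodup_append', List.mem_append] at hn hv
  obtain ⟨_, ⟨_, _, hn1⟩, hn2⟩ := hn
  rw [legalRun_append, legalRun_append] at hl
  obtain ⟨hl1, hl2, hl3⟩ := hl
  have hu1 : u ∉ computedList o₁ := fun h => hn2 h (List.mem_append_left _ hu)
  rcases hv with hv | hv | hv
  · rcases hl1.pre_present hv huv with h | h
    · exact absurd h hs
    · exact absurd h hu1
  · exact hv
  -- After the segment `u` is nowhere: not in the cache, not written during the segment, not in slow
  -- memory before it, and not computed again.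
  · rcases hl3.pre_present hv huv with (h | ⟨a, ha⟩) | h
    · exact absurd h h1
    · rcases slow_runOps ha with h | h
      · rcases hl1.present_of_present (Or.inr h) with h | h
        · exact absurd h hs
        · exact absurd h hu1
      · exact absurd h h2
    · exact absurd h (hn1 hu)

end Runs

/-! ### Subtrees -/

/-- This carries "computed in the segment" from any partial minimum to the root; `induction_down`
carries it from the root to all leaves. -/
theorem AggTree.induction_up {T : AggTree} {P : AggTree → Prop}
    (h : ∀ l r, (AggTree.node l r).IsSubtree T → P l ∨ P r → P (.node l r)) {t : AggTree}
    (ht : t.IsSubtree T) (hP : P t) : P T := by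
  induction T with
  | leaf k => simp only [IsSubtree] at ht; exact ht ▸ hP
  | node a b iha ihb =>
    rcases ht with rfl | ht | ht
    · exact hP
    · exact h a b (isSubtree_refl _)
        (Or.inl (iha (fun l r hs => h l r (Or.inr (Or.inl hs))) ht))
    · exact h a b (isSubtree_refl _)
        (Or.inr (ihb (fun l r hs => h l r (Or.inr (Or.inr hs))) ht))

theorem AggTree.induction_down {T : AggTree} {P : AggTree → Prop}
    (h : ∀ l r, (AggTree.node l r).IsSubtree T → P (.node l r) → P l ∧ P r) {t : AggTree}
    (ht : t.IsSubtree T) (hP : P T) : P t := by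
  induction T with
  | leaf k => simp only [IsSubtree] at ht; exact ht ▸ hP
  | node a b iha ihb =>
    have h0 := h a b (isSubtree_refl _) hP
    rcases ht with rfl | ht | ht
    · exact hP
    · exact iha (fun l r hs => h l r (Or.inr (Or.inl hs))) ht h0.1
    · exact ihb (fun l r hs => h l r (Or.inr (Or.inr hs))) ht h0.2

theorem AggTree.leaf_isSubtree_iff {k : ℕ} (t : AggTree) :
    (AggTree.leaf k).IsSubtree t ↔ k ∈ t.leaves := by
  induction t with
  | leaf m => simp [IsSubtree, leaves]
  | node a b iha ihb => simp [IsSubtree, leaves, iha, ihb]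

theorem AggTree.size_le_of_isSubtree {s t : AggTree} (h : s.IsSubtree t) : s.size ≤ t.size := by
  induction t with
  | leaf m => simp only [IsSubtree] at h; exact h ▸ le_rfl
  | node a b iha ihb =>
    rcases h with rfl | h | h
    · exact le_rfl
    · have := iha h; simp only [size]; omega
    · have := ihb h; simp only [size]; omega

/-! ### The vertices evaluated by a schedule -/

section BST

variable {n : ℕ} (T : AggTrees n)

theorem isBSTVertex_leaf {i j k : ℕ} (h1 : 1 ≤ i) (h2 : i ≤ k) (h3 : k < j) (h4 : j ≤ n) :
    IsBSTVertex T (.agg i j (.leaf k)) := by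
  refine ⟨h1, by omega, h4, ?_⟩
  rw [AggTree.leaf_isSubtree_iff, (T.leaves_perm i j h1 (by omega) h4).mem_iff]
  simp; omega

theorem not_present_agg (i j : ℕ) (t : AggTree) :
    ¬ (⟨∅, bstInput n⟩ : MemState BSTVertex).Present (.agg i j t) := by
  rintro (h | ⟨a, h⟩)
  · simp at h
  · simp only [bstInput] at h
    split_ifs at h <;> simp at h

theorem root_mem_outputs (hn : 2 ≤ n) : BSTVertex.agg 1 n (T.tree 1 n) ∈ (bstCDAG T).outputs := by
  refine ⟨⟨le_rfl, by omega, le_rfl, AggTree.isSubtree_refl _⟩, fun w hw h => ?_⟩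
  change IsBSTVertex T w at hw
  change _ ∈ bstPre T w at h
  match w with
  | .p l => simp [bstPre] at h
  | .q l => simp [bstPre] at h
  | .cum i j =>
    simp only [bstPre, cumVertex, Finset.mem_insert, Finset.mem_singleton] at h
    split_ifs at h <;> simp at h
  | .agg i j (.leaf k) =>
    have hk := split_mem_range T hw
    have h1 := hw.1
    have h3 := hw.2.2.1
    simp only [bstPre, cumVertex, rootVertex, Finset.mem_insert, Finset.mem_singleton] at h
    grind
  | .agg i j (.node l r) =>
    simp only [bstPre, Finset.mem_insert, Finset.mem_singleton, BSTVertex.agg.injEq] at h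
    have h4 := hw.2.2.2
    rcases h with ⟨rfl, rfl, h⟩ | ⟨rfl, rfl, h⟩ <;> subst h <;>
    · have := AggTree.size_le_of_isSubtree h4
      simp only [AggTree.size] at this
      omega

variable {T} {M B : ℕ} {ops : List (MemOp BSTVertex)}

theorem tree_mem_computed (hl : LegalRun (bstCDAG T) M B ⟨∅, bstInput n⟩ ops) {i j : ℕ}
    {t : AggTree} (ht : t.IsSubtree (T.tree i j))
    (h : BSTVertex.agg i j (T.tree i j) ∈ computedList ops) :
    BSTVertex.agg i j t ∈ computedList ops := by
  refine AggTree.induction_down (P := fun t => BSTVertex.agg i j t ∈ computedList ops)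
    (fun l r _ h => ⟨?_, ?_⟩) ht h
  · exact (hl.pre_present h (u := .agg i j l) (by simp [bstCDAG, bstPre])).resolve_left
      (not_present_agg _ _ _)
  · exact (hl.pre_present h (u := .agg i j r) (by simp [bstCDAG, bstPre])).resolve_left
      (not_present_agg _ _ _)

/-- S(1, n) is needed at the end and is no input. Its split j uses S(1, j), and the split i - 1 of
S(1, j) uses S(i, j), so every subproblem is needed. -/
theorem agg_mem_computed (hn : 2 ≤ n) (h : IsNRSchedule (bstCDAG T) (bstInput n) M B ops)
    {i j : ℕ} {t : AggTree} (hi : 1 ≤ i) (hij : i < j) (hj : j ≤ n)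
    (ht : t.IsSubtree (T.tree i j)) : BSTVertex.agg i j t ∈ computedList ops := by
  have h1 : BSTVertex.agg 1 n (T.tree 1 n) ∈ computedList ops :=
    (h.1.present_of_present (Or.inr (h.2.2 _ (root_mem_outputs T hn)))).resolve_left
      (not_present_agg _ _ _)
  have h2 : ∀ j, 1 < j → j ≤ n → BSTVertex.agg 1 j (T.tree 1 j) ∈ computedList ops := by
    intro j hj1 hj
    rcases eq_or_lt_of_le hj with rfl | hj
    · exact h1
    · have h3 := tree_mem_computed h.1
        (isBSTVertex_leaf T (k := j) le_rfl hj1.le hj le_rfl).2.2.2 h1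
      exact (h.1.pre_present h3 (u := .agg 1 j (T.tree 1 j))
        (by simp [bstCDAG, bstPre, rootVertex, hj1.ne])).resolve_left (not_present_agg _ _ _)
  refine tree_mem_computed h.1 ht ?_
  rcases eq_or_lt_of_le hi with rfl | hi
  · exact h2 j hij hj
  · have h3 := tree_mem_computed h.1
        (isBSTVertex_leaf T (k := i - 1) le_rfl (by omega) (by omega) hj).2.2.2
        (h2 j (by omega) hj)
    refine (h.1.pre_present h3 (u := .agg i j (T.tree i j)) ?_).resolve_left
      (not_present_agg _ _ _)
    have : i - 1 + 1 = i := by omega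
    simp [bstCDAG, bstPre, rootVertex, this, hij.ne]

end BST

/-! ### Counting triples by their projections -/

/-- Slice by the first coordinate. The slice at i injects into pairs of elements of the slice P_i,
and also into P through `(k + 1, j)`; the geometric mean of the two bounds is |P_i|·√|P|, and
summing over i gives |L| ≤ |P|^(3/2). -/
theorem card_sq_le_card_cube (P : Finset (ℕ × ℕ)) (L : Finset (ℕ × ℕ × ℕ))
    (h : ∀ i k j, (i, k, j) ∈ L → (i, k) ∈ P ∧ (k + 1, j) ∈ P ∧ (i, j) ∈ P) :
    L.card ^ 2 ≤ P.card ^ 3 := by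
  have h1 : ∀ i, (L.filter (·.1 = i)).card ≤ (P.filter (·.1 = i)).card ^ 2 := by
    intro i
    rw [sq, ← Finset.card_product]
    refine Finset.card_le_card_of_injOn (fun x => ((x.1, x.2.1), (x.1, x.2.2))) ?_ ?_
    · rintro ⟨a, k, j⟩ hx
      simp only [Finset.coe_filter, Set.mem_ofPred_eq] at hx
      obtain ⟨hx, rfl⟩ := hx
      simp [h _ _ _ hx]
    · rintro ⟨a, k, j⟩ _ ⟨a', k', j'⟩ _ he
      simp only [Prod.mk.injEq] at he ⊢
      tauto
  have h2 : ∀ i, (L.filter (·.1 = i)).card ≤ P.card := by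
    intro i
    refine Finset.card_le_card_of_injOn (fun x => (x.2.1 + 1, x.2.2)) ?_ ?_
    · rintro ⟨a, k, j⟩ hx
      simp only [Finset.coe_filter, Set.mem_ofPred_eq] at hx
      exact (h _ _ _ hx.1).2.1
    · rintro ⟨a, k, j⟩ ha ⟨a', k', j'⟩ ha' he
      simp only [Finset.coe_filter, Set.mem_ofPred_eq] at ha ha'
      simp only [Prod.mk.injEq, Nat.add_right_cancel_iff] at he ⊢
      exact ⟨ha.2.trans ha'.2.symm, he⟩
  have h3 : ∀ i, ((L.filter (·.1 = i)).card : ℝ) ≤ (P.filter (·.1 = i)).card * √P.card := by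
    intro i
    have h4 : (((L.filter (·.1 = i)).card : ℝ)) ^ 2 ≤
        ((P.filter (·.1 = i)).card * √P.card) ^ 2 := by
      rw [mul_pow, Real.sq_sqrt (Nat.cast_nonneg _), sq]
      exact_mod_cast Nat.mul_le_mul (h1 i) (h2 i)
    exact le_of_sq_le_sq h4 (by positivity)
  have h5 : (L.card : ℝ) ≤ P.card * √P.card := by
    have e1 : (P.card : ℝ) = ∑ i ∈ P.image Prod.fst, ((P.filter (·.1 = i)).card : ℝ) := by
      exact_mod_cast Finset.card_eq_sum_card_image Prod.fst P
    have e2 : (L.card : ℝ) = ∑ i ∈ P.image Prod.fst, ((L.filter (·.1 = i)).card : ℝ) := by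
      refine mod_cast Finset.card_eq_sum_card_fiberwise ?_
      rintro ⟨i, k, j⟩ hx
      exact Finset.mem_coe.2 (Finset.mem_image.2 ⟨_, (h _ _ _ hx).1, rfl⟩)
    calc (L.card : ℝ) ≤ ∑ i ∈ P.image Prod.fst, ((P.filter (·.1 = i)).card : ℝ) * √P.card := by
          rw [e2]
          exact Finset.sum_le_sum fun i _ => h3 i
      _ = P.card * √P.card := by rw [← Finset.sum_mul, ← e1]
  have h6 : (L.card : ℝ) ^ 2 ≤ (P.card * √P.card) ^ 2 := by gcongr
  rw [mul_pow, Real.sq_sqrt (Nat.cast_nonneg _)] at h6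
  have h7 : (L.card : ℝ) ^ 2 ≤ (P.card : ℝ) ^ 3 := h6.trans (by ring_nf; exact le_rfl)
  exact_mod_cast h7

/-! ### Splits evaluated in a segment -/

/-- The triple `(i, k, j)` if the vertex is the candidate of `S(i, j)` with split position `k`. -/
def splitOf : BSTVertex → Option (ℕ × ℕ × ℕ)
  | .agg i j (.leaf k) => some (i, k, j)
  | _ => none

theorem splitOf_eq_some {v : BSTVertex} {i k j : ℕ} :
    splitOf v = some (i, k, j) ↔ v = .agg i j (.leaf k) := by
  cases v with
  | agg i j t => cases t <;> simp [splitOf]; tauto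
  | _ => simp [splitOf]

/-- The splits evaluated by a list of operations. -/
def splitList (ops : List (MemOp BSTVertex)) : List (ℕ × ℕ × ℕ) :=
  (computedList ops).filterMap splitOf

theorem mem_splitList {ops : List (MemOp BSTVertex)} {i k j : ℕ} :
    (i, k, j) ∈ splitList ops ↔ BSTVertex.agg i j (.leaf k) ∈ computedList ops := by
  simp [splitList, splitOf_eq_some]

theorem splitList_append (o₁ o₂ : List (MemOp BSTVertex)) :
    splitList (o₁ ++ o₂) = splitList o₁ ++ splitList o₂ := by
  simp [splitList, computedList_append]

theorem nodup_splitList {ops : List (MemOp BSTVertex)} (h : (computedList ops).Nodup) :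
    (splitList ops).Nodup := by
  refine h.filterMap ?_
  rintro v w ⟨i, k, j⟩ hv hw
  rw [Option.mem_def, splitOf_eq_some] at hv hw
  rw [hv, hw]

/-- One operation evaluates at most one split, so the count passes through every intermediate value.
-/
theorem exists_append_length_splitList {N : ℕ} {ops : List (MemOp BSTVertex)}
    (h : N ≤ (splitList ops).length) :
    ∃ o₁ o₂, ops = o₁ ++ o₂ ∧ (splitList o₁).length = N := by
  induction ops generalizing N with
  | nil => exact ⟨[], [], rfl, by simpa [splitList, computedList, eq_comm] using h⟩
  | cons o os ih =>
    have h0 : splitList (o :: os) = splitList [o] ++ splitList os := splitList_append [o] os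
    have h1 : (splitList [o]).length ≤ 1 := by
      refine (List.length_filterMap_le _ _).trans ?_
      cases o <;> simp [computedList]
    rcases Nat.eq_zero_or_pos N with rfl | hN
    · exact ⟨[], o :: os, rfl, rfl⟩
    · rw [h0, List.length_append] at h
      obtain ⟨o₁, o₂, rfl, h2⟩ := ih (N := N - (splitList [o]).length) (by omega)
      refine ⟨o :: o₁, o₂, rfl, ?_⟩
      rw [show o :: o₁ = [o] ++ o₁ from rfl, splitList_append, List.length_append]
      omega

/-- The subproblem to which a vertex belongs. -/
def pairOf : BSTVertex → ℕ × ℕ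
  | .agg i j _ => (i, j)
  | .q i => (i, i)
  -- Values of `p` and C belong to no subproblem; `(0, 0)` is not one, since subproblems have `1 ≤
  -- i`.
  | _ => (0, 0)

theorem pairOf_rootVertex {n : ℕ} (T : AggTrees n) (i j : ℕ) :
    pairOf (rootVertex T i j) = (i, j) := by
  unfold rootVertex
  split_ifs with h <;> simp [pairOf, h]

/-- The subproblems used or extended by a set of splits. -/
def touched (L : Finset (ℕ × ℕ × ℕ)) : Finset (ℕ × ℕ) :=
  L.image (fun x => (x.1, x.2.1)) ∪ L.image (fun x => (x.2.1 + 1, x.2.2)) ∪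
    L.image (fun x => (x.1, x.2.2))

theorem mem_touched {L : Finset (ℕ × ℕ × ℕ)} {i k j : ℕ} (h : (i, k, j) ∈ L) :
    (i, k) ∈ touched L ∧ (k + 1, j) ∈ touched L ∧ (i, j) ∈ touched L := by
  simp only [touched, Finset.mem_union, Finset.mem_image]
  exact ⟨Or.inl (Or.inl ⟨_, h, rfl⟩), Or.inl (Or.inr ⟨_, h, rfl⟩), Or.inr ⟨_, h, rfl⟩⟩

/-! ### The work of a segment against the words it moves -/

section Segment

variable {n M B : ℕ} {T : AggTrees n} {o₁ o₂ o₃ : List (MemOp BSTVertex)}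

/-- A subproblem touched in a segment none of whose values enters or leaves the segment has all
its splits, and all splits using its solution, evaluated in the segment. -/
theorem local_splits (hn : 2 ≤ n)
    (h : IsNRSchedule (bstCDAG T) (bstInput n) M B (o₁ ++ (o₂ ++ o₃))) {i j : ℕ}
    (hij : (i, j) ∈ touched (splitList o₂).toFinset)
    (hX : ∀ v, pairOf v = (i, j) → v ∉ (runOps ⟨∅, bstInput n⟩ o₁).cache ∧
      v ∉ (runOps (runOps ⟨∅, bstInput n⟩ o₁) o₂).cache ∧
      v ∉ movedBy (runOps ⟨∅, bstInput n⟩ o₁) o₂) :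
    (1 ≤ i ∧ i < j ∧ j ≤ n) ∧ (∀ k, i ≤ k → k < j → (i, k, j) ∈ splitList o₂) ∧
      (∀ l, j < l → l ≤ n → (i, j, l) ∈ splitList o₂) ∧
      (∀ l, 1 ≤ l → l < i → (l, i - 1, j) ∈ splitList o₂) := by
  have hl2 : LegalRun (bstCDAG T) M B (runOps ⟨∅, bstInput n⟩ o₁) o₂ := by
    have := h.1
    rw [legalRun_append, legalRun_append] at this
    exact this.2.1
  -- An operand of `(i, j)` used in the segment is neither there at its start nor moved in, hence is
  -- computed inside.
  have down : ∀ {u v : BSTVertex}, v ∈ computedList o₂ → u ∈ bstPre T v → pairOf u = (i, j) →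
      u ∈ computedList o₂ := by
    intro u v hv hu hp
    obtain ⟨h1, _, h3⟩ := hX u hp
    have := hl2.pre_mem hv (u := u) hu
    tauto
  -- Conversely, a value of `(i, j)` computed inside does not survive the segment, so its
  -- successors, which are all evaluated at some time, are evaluated inside.
  have up : ∀ {t v}, BSTVertex.agg i j t ∈ computedList o₂ → IsBSTVertex T v →
      (∃ a b s, v = BSTVertex.agg a b s) → BSTVertex.agg i j t ∈ bstPre T v →
      v ∈ computedList o₂ := by
    rintro t v ht hv ⟨a, b, s, rfl⟩ hu
    obtain ⟨_, h2, h3⟩ := hX _ (rfl : pairOf (.agg i j t) = (i, j))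
    exact h.1.succ_mem_segment h.2.1 (not_present_agg _ _ _) ht h2 h3
      (agg_mem_computed hn h hv.1 hv.2.1 hv.2.2.1 hv.2.2.2) hu
  -- A diagonal subproblem has the input `q i` as its solution; inputs are never computed, so `down`
  -- excludes it.
  have noq : ∀ {v}, v ∈ computedList o₂ → rootVertex T i j ∈ bstPre T v → i ≠ j := by
    rintro v hv hu rfl
    have h1 := down hv hu (pairOf_rootVertex T i i)
    obtain ⟨a, b, h1⟩ := exists_append_compute h1
    rw [h1, legalRun_append] at hl2
    have := hl2.2.1.2.1
    simp [rootVertex, bstCDAG, bstPre] at this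
  have vert : ∀ {v}, v ∈ computedList o₂ → IsBSTVertex T v := fun hv =>
    (hl2.exists_pre_subset hv).1
  have start : ∃ t, BSTVertex.agg i j t ∈ computedList o₂ := by
    simp only [touched, Finset.mem_union, Finset.mem_image, List.mem_toFinset] at hij
    rcases hij with (⟨⟨a, k, b⟩, hx, he⟩ | ⟨⟨a, k, b⟩, hx, he⟩) | ⟨⟨a, k, b⟩, hx, he⟩
    · obtain ⟨rfl, rfl⟩ := Prod.mk.inj he
      rw [mem_splitList] at hx
      have hr : rootVertex T a k ∈ bstPre T (.agg a b (.leaf k)) := by simp [bstPre]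
      have := down hx hr (pairOf_rootVertex T _ _)
      rw [rootVertex, if_neg (noq hx hr)] at this
      exact ⟨_, this⟩
    · obtain ⟨rfl, rfl⟩ := Prod.mk.inj he
      rw [mem_splitList] at hx
      have hr : rootVertex T (k + 1) b ∈ bstPre T (.agg a b (.leaf k)) := by simp [bstPre]
      have := down hx hr (pairOf_rootVertex T _ _)
      rw [rootVertex, if_neg (noq hx hr)] at this
      exact ⟨_, this⟩
    · obtain ⟨rfl, rfl⟩ := Prod.mk.inj he
      exact ⟨_, mem_splitList.1 hx⟩
  obtain ⟨t, ht⟩ := start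
  obtain ⟨hi, hlt, hj, hsub⟩ := vert ht
  -- Climb by `up` from the value found in the segment to the root; its splits then follow by
  -- `down`, its uses by `up`.
  have root : BSTVertex.agg i j (T.tree i j) ∈ computedList o₂ := by
    refine AggTree.induction_up (P := fun t => BSTVertex.agg i j t ∈ computedList o₂)
      (fun l r hs h => ?_) hsub ht
    rcases h with h | h
    · exact up h ⟨hi, hlt, hj, hs⟩ ⟨_, _, _, rfl⟩ (by simp [bstPre])
    · exact up h ⟨hi, hlt, hj, hs⟩ ⟨_, _, _, rfl⟩ (by simp [bstPre])
  refine ⟨⟨hi, hlt, hj⟩, fun k h1 h2 => ?_, fun l h1 h2 => ?_, fun l h1 h2 => ?_⟩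
  · rw [mem_splitList]
    refine AggTree.induction_down (P := fun t => BSTVertex.agg i j t ∈ computedList o₂)
      (fun l r _ h => ⟨down h (by simp [bstPre]) rfl, down h (by simp [bstPre]) rfl⟩)
      (isBSTVertex_leaf T hi h1 h2 hj).2.2.2 root
  · rw [mem_splitList]
    exact up root (isBSTVertex_leaf T hi hlt.le h1 h2) ⟨_, _, _, rfl⟩
      (by simp [bstPre, rootVertex, hlt.ne])
  · rw [mem_splitList]
    have : i - 1 + 1 = i := by omega
    exact up root (isBSTVertex_leaf T h1 (by omega) (by omega) hj) ⟨_, _, _, rfl⟩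
      (by simp [bstPre, rootVertex, hlt.ne, this])

theorem card_le_of_inj {P : Finset (ℕ × ℕ)} {L : Finset (ℕ × ℕ × ℕ)} (s : ℕ × ℕ → Finset ℕ)
    (f : (_ : ℕ × ℕ) × ℕ → ℕ × ℕ × ℕ) (h : ∀ p ∈ P, ∀ k ∈ s p, f ⟨p, k⟩ ∈ L)
    (hf : ∀ p ∈ P, ∀ k ∈ s p, ∀ p' ∈ P, ∀ k' ∈ s p', f ⟨p, k⟩ = f ⟨p', k'⟩ → p = p' ∧ k = k') :
    ∑ p ∈ P, (s p).card ≤ L.card := by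
  rw [← Finset.card_sigma]
  refine Finset.card_le_card_of_injOn f ?_ ?_
  · rintro ⟨p, k⟩ hx
    simp only [Finset.coe_sigma, Set.mem_sigma_iff, Finset.mem_coe] at hx
    exact h p hx.1 k hx.2
  · rintro ⟨p, k⟩ hx ⟨p', k'⟩ hx' he
    simp only [Finset.coe_sigma, Set.mem_sigma_iff, Finset.mem_coe] at hx hx'
    obtain ⟨rfl, rfl⟩ := hf p hx.1 k hx.2 p' hx'.1 k' hx'.2 he
    rfl

/-- Each pair accounts for j - i splits of its own, n - j splits as left operand and i - 1 as right
operand, n - 1 in all. Each of the three families injects into L, but they may overlap one another,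
hence the factor 3. -/
theorem card_local_mul_le {P : Finset (ℕ × ℕ)} {L : Finset (ℕ × ℕ × ℕ)}
    (h : ∀ i j, (i, j) ∈ P → (1 ≤ i ∧ i < j ∧ j ≤ n) ∧ (∀ k, i ≤ k → k < j → (i, k, j) ∈ L) ∧
      (∀ l, j < l → l ≤ n → (i, j, l) ∈ L) ∧ (∀ l, 1 ≤ l → l < i → (l, i - 1, j) ∈ L)) :
    P.card * (n - 1) ≤ 3 * L.card := by
  have h1 := card_le_of_inj (P := P) (L := L) (fun p => Finset.Ico p.1 p.2)
    (fun x => (x.1.1, x.2, x.1.2))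
    (fun p hp k hk => (h _ _ hp).2.1 k (Finset.mem_Ico.1 hk).1 (Finset.mem_Ico.1 hk).2)
    (fun p hp k hk p' hp' k' hk' he => by simp only [Prod.ext_iff] at he ⊢; tauto)
  have h2 := card_le_of_inj (P := P) (L := L) (fun p => Finset.Ioc p.2 n)
    (fun x => (x.1.1, x.1.2, x.2))
    (fun p hp k hk => (h _ _ hp).2.2.1 k (Finset.mem_Ioc.1 hk).1 (Finset.mem_Ioc.1 hk).2)
    (fun p hp k hk p' hp' k' hk' he => by simp only [Prod.ext_iff] at he ⊢; tauto)
  have h3 := card_le_of_inj (P := P) (L := L) (fun p => Finset.Ico 1 p.1)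
    (fun x => (x.2, x.1.1 - 1, x.1.2))
    (fun p hp k hk => (h _ _ hp).2.2.2 k (Finset.mem_Ico.1 hk).1 (Finset.mem_Ico.1 hk).2)
    -- The subtraction in `i - 1` is truncated, so injectivity needs `1 ≤ i` here.
    (fun p hp k hk p' hp' k' hk' he => by
      have a1 := (h _ _ hp).1.1
      have a2 := (h _ _ hp').1.1
      simp only [Prod.ext_iff] at he ⊢
      omega)
  have h4 : ∑ p ∈ P, (n - 1) = ∑ p ∈ P, ((Finset.Ico p.1 p.2).card + (Finset.Ioc p.2 n).card +
      (Finset.Ico 1 p.1).card) := by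
    refine Finset.sum_congr rfl fun p hp => ?_
    have := (h _ _ hp).1
    simp only [Nat.card_Ico, Nat.card_Ioc]
    omega
  rw [Finset.sum_add_distrib, Finset.sum_add_distrib, Finset.sum_const, smul_eq_mul] at h4
  omega

/-- The number of splits of a segment is controlled by the number of moved words. -/
theorem segment_bound (hn : 2 ≤ n)
    (h : IsNRSchedule (bstCDAG T) (bstInput n) M B (o₁ ++ (o₂ ++ o₃))) :
    ∃ a, a * (n - 1) ≤ 3 * (splitList o₂).length ∧
      (splitList o₂).length ^ 2 ≤ (a + 2 * M + B * totalIO o₂) ^ 3 := by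
  classical
  have hnd : (splitList o₂).Nodup := by
    have := nodup_splitList h.2.1
    rw [splitList_append, splitList_append] at this
    exact this.of_append_right.of_append_left
  set L := (splitList o₂).toFinset with hL
  have hcard : L.card = (splitList o₂).length := List.toFinset_card_of_nodup hnd
  set s := runOps ⟨∅, bstInput n⟩ o₁ with hs
  set X := s.cache ∪ (runOps s o₂).cache ∪ movedBy s o₂ with hX
  have hl := h.1
  rw [legalRun_append, legalRun_append] at hl
  have hs1 : s.cache.card ≤ M := hl.1.card_cache_le (by simp)
  have hs2 : (runOps s o₂).cache.card ≤ M := hl.2.1.card_cache_le hs1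
  have hs3 : (movedBy s o₂).card ≤ B * totalIO o₂ := hl.2.1.card_movedBy_le
  have hXc : X.card ≤ 2 * M + B * totalIO o₂ := by
    have a1 := Finset.card_union_le (s.cache ∪ (runOps s o₂).cache) (movedBy s o₂)
    have a2 := Finset.card_union_le s.cache (runOps s o₂).cache
    rw [← hX] at a1
    omega
  refine ⟨(touched L \ X.image pairOf).card, ?_, ?_⟩
  · rw [← hcard]
    refine card_local_mul_le fun i j hij => ?_
    rw [Finset.mem_sdiff] at hij
    have := local_splits hn h hij.1 fun v hv => by
      have : v ∉ X := fun hvX => hij.2 (Finset.mem_image.2 ⟨v, hvX, hv⟩)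
      simp only [hX, Finset.mem_union] at this
      tauto
    simpa [hL] using this
  · rw [← hcard]
    refine (card_sq_le_card_cube (touched L) L fun i k j h => mem_touched h).trans ?_
    gcongr
    have a1 := Finset.card_le_card_sdiff_add_card (s := touched L) (t := X.image pairOf)
    have a2 := Finset.card_image_le (s := X) (f := pairOf)
    omega

/-- The length 8(⌊√M⌋ + 1)M is chosen so that its square exceeds (4M)³, where 4M bounds M local
subproblems, two cache contents and fewer than M moved words. -/
theorem segment_moves (hM : 4 ≤ M) (hn : 10000 * M < n ^ 2)
    (h : IsNRSchedule (bstCDAG T) (bstInput n) M B (o₁ ++ (o₂ ++ o₃)))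
    (hN : (splitList o₂).length = 8 * (Nat.sqrt M + 1) * M) : M ≤ B * totalIO o₂ := by
  by_contra! hlt
  set r := Nat.sqrt M with hr
  have r1 : r * r ≤ M := Nat.sqrt_le M
  have r2 : M < (r + 1) * (r + 1) := Nat.lt_succ_sqrt M
  have r3 : 2 ≤ r := by
    by_contra! h3
    have : r ≤ 1 := by omega
    have : (r + 1) * (r + 1) ≤ 2 * 2 := Nat.mul_le_mul (by omega) (by omega)
    omega
  have hn2 : 100 * r < n := by
    by_contra! h3
    have : n ^ 2 ≤ (100 * r) ^ 2 := Nat.pow_le_pow_left h3 2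
    nlinarith
  obtain ⟨a, ha, hb⟩ := segment_bound (by omega) h
  rw [hN] at ha hb
  -- Otherwise 100r ≤ 24r + 24 with r = ⌊√M⌋ ≥ 2. This is where M has to be small against n².
  have ha2 : a ≤ M := by
    by_contra! h3
    have h4 : M * (100 * r) ≤ a * (n - 1) := Nat.mul_le_mul h3.le (by omega)
    have h5 : 3 * (8 * (r + 1) * M) = M * (24 * r + 24) := by ring
    have h6 := Nat.le_of_mul_le_mul_left (h5 ▸ h4.trans ha) (by omega)
    omega
  have hb2 : (8 * (r + 1) * M) ^ 2 ≤ (4 * M) ^ 3 := hb.trans (by gcongr; omega)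
  have : (4 * M) ^ 3 < (8 * (r + 1) * M) ^ 2 := by
    calc (4 * M) ^ 3 = 64 * M ^ 2 * M := by ring
      _ < 64 * M ^ 2 * ((r + 1) * (r + 1)) := by gcongr
      _ = (8 * (r + 1) * M) ^ 2 := by ring
  omega

theorem mul_le_totalIO (hM : 4 ≤ M) (hn : 10000 * M < n ^ 2) (g : ℕ)
    (o₁ o₂ : List (MemOp BSTVertex))
    (h : IsNRSchedule (bstCDAG T) (bstInput n) M B (o₁ ++ o₂))
    (hg : g * (8 * (Nat.sqrt M + 1) * M) ≤ (splitList o₂).length) : g * M ≤ B * totalIO o₂ := by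
  induction g generalizing o₁ o₂ with
  | zero => simp
  | succ g ih =>
    rw [add_mul, one_mul] at hg
    obtain ⟨o, o', rfl, ho⟩ := exists_append_length_splitList ((Nat.le_add_left _ _).trans hg)
    have h1 := segment_moves hM hn h ho
    rw [← List.append_assoc] at h
    have h2 := ih (o₁ ++ o) o' h (by
      rw [splitList_append, List.length_append] at hg
      omega)
    rw [totalIO_append, mul_add, add_mul]
    omega

end Segment

/-! ### The lower bound -/

theorem length_splitList_ge {n M B : ℕ} {T : AggTrees n} {ops : List (MemOp BSTVertex)}
    (hn : 2 ≤ n) (h : IsNRSchedule (bstCDAG T) (bstInput n) M B ops) :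
    (n / 3) ^ 3 ≤ (splitList ops).length := by
  set m := n / 3 with hm
  -- A box in which `i ≤ k < j` holds automatically.
  have h1 : ((Finset.Icc 1 m) ×ˢ (Finset.Ico m (2 * m)) ×ˢ (Finset.Ioc (2 * m) (3 * m))).card
      ≤ (splitList ops).toFinset.card := by
    refine Finset.card_le_card fun x hx => ?_
    obtain ⟨i, k, j⟩ := x
    simp only [Finset.mem_product, Finset.mem_Icc, Finset.mem_Ico, Finset.mem_Ioc] at hx
    rw [List.mem_toFinset, mem_splitList]
    have := isBSTVertex_leaf T (i := i) (k := k) (j := j) (by omega) (by omega) (by omega)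
      (by omega)
    exact agg_mem_computed hn h this.1 this.2.1 this.2.2.1 this.2.2.2
  have h2 := h1.trans (List.toFinset_card_le _)
  simp only [Finset.card_product, Nat.card_Icc, Nat.card_Ico, Nat.card_Ioc] at h2
  have e1 : m + 1 - 1 = m := by omega
  have e2 : 2 * m - m = m := by omega
  have e3 : 3 * m - 2 * m = m := by omega
  rw [e1, e2, e3] at h2
  calc m ^ 3 = m * (m * m) := by ring
    _ ≤ _ := h2

theorem lower_bound {n M B : ℕ} (T : AggTrees n) (hB : 1 ≤ B) (hM : 4 ≤ M)
    (hn : (M : ℝ) < 1 / 10000 * (n : ℝ) ^ 2) :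
    ENNReal.ofReal (1 / 10000 * ((n : ℝ) ^ 3 / ((B : ℝ) * √(M : ℝ)))) ≤
      (bstIO T M B : ℝ≥0∞) := by
  have hn1 : 10000 * M < n ^ 2 := by
    have : (10000 * M : ℝ) < (n : ℝ) ^ 2 := by linarith
    exact_mod_cast this
  have hn2 : 200 < n := by nlinarith
  have hMr : (0 : ℝ) < M := by exact_mod_cast (by omega : 0 < M)
  have hBr : (0 : ℝ) < B := by exact_mod_cast hB
  set N := 8 * (Nat.sqrt M + 1) * M with hN
  have hNr : (N : ℝ) ≤ 12 * √M * M := by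
    have h1 : (Nat.sqrt M : ℝ) ≤ √M := Real.nat_sqrt_le_real_sqrt
    have h2 : (2 : ℝ) ≤ √M := by
      rw [Real.le_sqrt (by norm_num) hMr.le]
      norm_num
      exact_mod_cast hM
    rw [hN]
    push_cast
    have : (8 * (Nat.sqrt M + 1) : ℝ) ≤ 12 * √M := by linarith
    gcongr
  have hNpos : 0 < N := by positivity
  have key : ∀ ops, IsNRSchedule (bstCDAG T) (bstInput n) M B ops →
      1 / 10000 * ((n : ℝ) ^ 3 / ((B : ℝ) * √(M : ℝ))) ≤ totalIO ops := by
    intro ops h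
    have h1 := length_splitList_ge (by omega) h
    have h2 := mul_le_totalIO hM hn1 ((splitList ops).length / N) [] ops h (Nat.div_mul_le_self _ _)
    have h3 : ((splitList ops).length : ℝ) ≤ ((splitList ops).length / N : ℕ) * N + N := by
      have := Nat.lt_div_mul_add (a := (splitList ops).length) hNpos
      exact_mod_cast this.le
    set g := (splitList ops).length / N
    have h4 : (n : ℝ) / 4 ≤ (n / 3 : ℕ) := by
      have : n ≤ 4 * (n / 3) := by omega
      have : (n : ℝ) ≤ 4 * (n / 3 : ℕ) := by exact_mod_cast this
      linarith
    have h5 : ((n : ℝ) / 4) ^ 3 ≤ (splitList ops).length := by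
      refine (pow_le_pow_left₀ (by positivity) h4 3).trans ?_
      exact_mod_cast h1
    have h6 : √(M : ℝ) ≤ n / 100 := by
      rw [Real.sqrt_le_left (by positivity)]
      nlinarith
    have h7 : (M : ℝ) * √M ≤ 1 / 10000 * (n : ℝ) ^ 2 * (n / 100) := by gcongr
    have h8 : (n : ℝ) ^ 3 / 64 ≤ (g : ℝ) * N + N := by
      calc (n : ℝ) ^ 3 / 64 = (n / 4) ^ 3 := by ring
        _ ≤ _ := h5.trans h3
    -- The incomplete last segment has at most N ≤ 12·M·√M ≤ 12n³/10⁶ splits, which the gap between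
    -- n³/64 and n³/100 absorbs.
    have h9 : (n : ℝ) ^ 3 / 100 ≤ (g : ℝ) * N := by
      nlinarith [pow_nonneg (Nat.cast_nonneg (α := ℝ) n) 3]
    have h10 : (n : ℝ) ^ 3 / 100 ≤ 12 * √M * (g * M) := by
      calc (n : ℝ) ^ 3 / 100 ≤ g * N := h9
        _ ≤ g * (12 * √M * M) := by gcongr
        _ = 12 * √M * (g * M) := by ring
    have h11 : (g : ℝ) * M ≤ B * totalIO ops := by exact_mod_cast h2
    have hs : 0 < √(M : ℝ) := Real.sqrt_pos.2 hMr
    have h12 : (n : ℝ) ^ 3 / 100 ≤ 12 * √M * (B * totalIO ops) := h10.trans (by gcongr)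
    rw [← mul_div_assoc, div_le_iff₀ (by positivity)]
    nlinarith [pow_nonneg (Nat.cast_nonneg (α := ℝ) n) 3]
  rw [bstIO, ioComplexityNR]
  simp only [ENat.toENNReal_iInf]
  refine le_iInf₂ fun ops h => ?_
  rw [ENat.toENNReal_coe, ← ENNReal.ofReal_natCast]
  exact ENNReal.ofReal_le_ofReal (key ops h)

/-! ### Schedules described by groups of values -/

/-- A placement in the slow memory: the group `g` occupies consecutive cells from `base g` on and
consists of the values of the list `items g`. -/
structure Layout (V Γ : Type) where
  base : Γ → ℕ
  items : Γ → List V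

/-- The slow memory contains the group `g` in its place. -/
def Layout.Holds {V Γ : Type} (Λ : Layout V Γ) (slow : ℕ → Option V) (g : Γ) : Prop :=
  ∀ t < (Λ.items g).length, slow (Λ.base g + t) = (Λ.items g)[t]?

/-- The cells of two groups are disjoint. -/
def Layout.Apart {V Γ : Type} (Λ : Layout V Γ) (g g' : Γ) : Prop :=
  Λ.base g + (Λ.items g).length ≤ Λ.base g' ∨ Λ.base g' + (Λ.items g').length ≤ Λ.base g

/-- What is known about a state of the machine: the values in the cache, groups that are stored
in the slow memory, and values among which all those computed so far are. -/
structure BlockState (V Γ : Type) where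
  cache : Finset V
  saved : Set Γ
  done : Set V

section Reach

variable {V Γ : Type} [DecidableEq V]

/-- From `σ` one can get to `τ` with at most `w` I/O operations, computing only values that are
not in `σ.done`, none of them twice. -/
def Reach (G : CDAG V) (M B : ℕ) (Λ : Layout V Γ) (σ τ : BlockState V Γ) (w : ℕ) : Prop :=
  σ.done ⊆ τ.done ∧ ∀ s : MemState V, s.cache = σ.cache → (∀ g ∈ σ.saved, Λ.Holds s.slow g) →
    ∃ ops, LegalRun G M B s ops ∧ (runOps s ops).cache = τ.cache ∧
      (∀ g ∈ τ.saved, Λ.Holds (runOps s ops).slow g) ∧ (computedList ops).Nodup ∧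
      (∀ v ∈ computedList ops, v ∉ σ.done ∧ v ∈ τ.done) ∧ totalIO ops ≤ w

variable {G : CDAG V} {M B : ℕ} {Λ : Layout V Γ}

/-- No value is computed in both parts: the first computes only values in `τ.done`, the second only
values outside it. -/
theorem Reach.trans {σ τ υ : BlockState V Γ} {w w' : ℕ} (h : Reach G M B Λ σ τ w)
    (h' : Reach G M B Λ τ υ w') : Reach G M B Λ σ υ (w + w') := by
  refine ⟨h.1.trans h'.1, fun s hs hsl => ?_⟩
  obtain ⟨o₁, a1, a2, a3, a4, a5, a6⟩ := h.2 s hs hsl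
  obtain ⟨o₂, b1, b2, b3, b4, b5, b6⟩ := h'.2 _ a2 a3
  refine ⟨o₁ ++ o₂, (legalRun_append _ _ _ _ _ _).2 ⟨a1, b1⟩, ?_, ?_, ?_, ?_, ?_⟩
  · rwa [runOps_append]
  · rwa [runOps_append]
  · rw [computedList_append, List.nodup_append']
    exact ⟨a4, b4, fun v h1 h2 => (b5 v h2).1 (a5 v h1).2⟩
  · intro v hv
    rw [computedList_append, List.mem_append] at hv
    rcases hv with hv | hv
    · exact ⟨(a5 v hv).1, h'.1 (a5 v hv).2⟩
    · exact ⟨fun h1 => (b5 v hv).1 (h.1 h1), (b5 v hv).2⟩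
  · rw [totalIO_append]
    omega

/-- Besides emptying the cache, this serves as the weakening rule: stored groups may be forgotten
and `done` enlarged at no cost. -/
theorem Reach.discard {C C' : Finset V} {S S' : Set Γ} {D D' : Set V} (hC : C' ⊆ C)
    (hS : S' ⊆ S) (hD : D ⊆ D') (hM : C.card ≤ M) :
    Reach G M B Λ ⟨C, S, D⟩ ⟨C', S', D'⟩ 0 := by
  refine ⟨hD, fun s hs hsl => ?_⟩
  have key : ∀ l : List V, ∀ s : MemState V, s.cache.card ≤ M →
      LegalRun G M B s (l.map .discard) ∧
      (runOps s (l.map .discard)).cache = s.cache \ l.toFinset ∧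
      (runOps s (l.map .discard)).slow = s.slow ∧
      computedList (l.map MemOp.discard) = [] ∧ totalIO (l.map MemOp.discard) = 0 := by
    intro l
    induction l with
    | nil => intro s _; simp [LegalRun, runOps, computedList, totalIO]
    | cons v l ih =>
      intro s h
      have h0 : (MemOp.apply s (.discard v)).cache.card ≤ M :=
        (Finset.card_le_card (Finset.erase_subset _ _)).trans h
      obtain ⟨h1, h2, h3, h4, h5⟩ := ih _ h0
      refine ⟨⟨trivial, h0, h1⟩, ?_, h3, h4, ?_⟩
      · rw [List.map_cons, runOps_cons, h2]
        ext x
        simp only [MemOp.apply, Finset.mem_sdiff, Finset.mem_erase, List.toFinset_cons,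
          Finset.mem_insert]
        tauto
      · simpa [totalIO, MemOp.ioCost] using h5
  obtain ⟨h1, h2, h3, h4, h5⟩ := key (C \ C').toList s (hs ▸ hM)
  refine ⟨_, h1, ?_, ?_, ?_, ?_, h5.le⟩
  · rw [h2, hs, Finset.toList_toFinset]
    simp only
    rw [sdiff_sdiff_right_self]
    exact inf_eq_right.2 hC
  · rw [h3]
    exact fun g hg => hsl g (hS hg)
  · simp [h4]
  · simp [h4]

theorem Reach.refl (σ : BlockState V Γ) : Reach G M B Λ σ σ 0 :=
  ⟨subset_rfl, fun s hs hsl => ⟨[], trivial, hs, hsl, List.nodup_nil, by simp [computedList],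
    by simp [totalIO]⟩⟩

theorem Reach.mono {σ τ : BlockState V Γ} {w w' : ℕ} (h : Reach G M B Λ σ τ w) (hw : w ≤ w') :
    Reach G M B Λ σ τ w' := by
  refine ⟨h.1, fun s hs hsl => ?_⟩
  obtain ⟨o₁, a1, a2, a3, a4, a5, a6⟩ := h.2 s hs hsl
  exact ⟨o₁, a1, a2, a3, a4, a5, a6.trans hw⟩

theorem Reach.weaken {σ : BlockState V Γ} {C : Finset V} {S S' : Set Γ} {D D' : Set V} {w : ℕ}
    (h : Reach G M B Λ σ ⟨C, S, D⟩ w) (hS : S' ⊆ S) (hD : D ⊆ D') :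
    Reach G M B Λ σ ⟨C, S', D'⟩ w := by
  refine ⟨h.1.trans hD, fun s hs hsl => ?_⟩
  obtain ⟨o₁, a1, a2, a3, a4, a5, a6⟩ := h.2 s hs hsl
  exact ⟨o₁, a1, a2, fun g hg => a3 g (hS hg), a4, fun v hv => ⟨(a5 v hv).1, hD (a5 v hv).2⟩, a6⟩

theorem Reach.compute {C : Finset V} {S : Set Γ} {D : Set V} {v : V} (hv : v ∈ G.vertices)
    (hne : (G.pre v).Nonempty) (hpre : G.pre v ⊆ C) (hD : v ∉ D) (hM : (insert v C).card ≤ M) :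
    Reach G M B Λ ⟨C, S, D⟩ ⟨insert v C, S, insert v D⟩ 0 := by
  refine ⟨Set.subset_insert _ _, fun s hs hsl => ⟨[.compute v], ⟨⟨hv, hne, ?_⟩, ?_, trivial⟩,
    ?_, hsl, ?_, ?_, ?_⟩⟩
  · rwa [hs]
  · simpa [MemOp.apply, hs] using hM
  · simp [runOps, MemOp.apply, hs]
  · simp [computedList]
  · simpa [computedList] using hD
  · simp [totalIO, MemOp.ioCost]

theorem exists_reads (a : ℕ) (l : List V) (s : MemState V)
    (h : ∀ t < l.length, s.slow (a + t) = l[t]?) (hM : (s.cache ∪ l.toFinset).card ≤ M) {κ : ℕ}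
    (hκ : l.length ≤ κ * B) :
    ∃ ops, LegalRun G M B s ops ∧ (runOps s ops).cache = s.cache ∪ l.toFinset ∧
      (runOps s ops).slow = s.slow ∧ computedList ops = [] ∧ totalIO ops ≤ κ := by
  induction κ generalizing a l s with
  | zero =>
    obtain rfl : l = [] := by simpa using hκ
    exact ⟨[], trivial, by simp [runOps], rfl, rfl, by simp [totalIO]⟩
  | succ κ ih =>
    have hl : l.take B ++ l.drop B = l := List.take_append_drop B l
    -- Only the cells of the list are read, even if fewer than `B` remain, so that the cache content
    -- is known exactly.
    have hc : (MemOp.apply s (.read a (l.take B).length)).cache =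
        s.cache ∪ (l.take B).toFinset := by
      simp only [MemOp.apply]
      congr 1
      ext x
      simp only [Finset.mem_biUnion, Finset.mem_range, Option.mem_toFinset, Option.mem_def,
        List.mem_toFinset, List.mem_iff_getElem?]
      constructor
      · rintro ⟨t, ht, hx⟩
        rw [h t (ht.trans_le (List.length_take_le' B l))] at hx
        refine ⟨t, ?_⟩
        rwa [List.getElem?_take_of_lt (ht.trans_le (List.length_take_le B l))]
      · rintro ⟨t, hx⟩
        have ht : t < (l.take B).length := (List.getElem?_eq_some_iff.1 hx).1
        refine ⟨t, ht, ?_⟩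
        rw [h t (ht.trans_le (List.length_take_le' B l))]
        rwa [List.getElem?_take_of_lt (ht.trans_le (List.length_take_le B l))] at hx
    have hu : s.cache ∪ (l.take B).toFinset ∪ (l.drop B).toFinset = s.cache ∪ l.toFinset := by
      rw [Finset.union_assoc, ← List.toFinset_append, hl]
    obtain ⟨ops, h1, h2, h3, h4, h5⟩ := ih (a + (l.take B).length) (l.drop B)
      (MemOp.apply s (.read a (l.take B).length)) (by
        intro t ht
        have := h ((l.take B).length + t) (by simp at ht ⊢; omega)
        simp only [MemOp.apply]
        rw [add_assoc, this, List.getElem?_drop]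
        simp only [List.length_take]
        congr 1
        simp at ht
        omega) (by rw [hc, hu]; exact hM)
      (by rw [List.length_drop]; rw [add_mul] at hκ; omega)
    refine ⟨.read a (l.take B).length :: ops, ⟨List.length_take_le B l, ?_, h1⟩, ?_, h3, h4, ?_⟩
    · rw [hc]
      refine (Finset.card_le_card ?_).trans hM
      rw [← hu]
      exact Finset.subset_union_left
    · rw [runOps_cons, h2, hc, hu]
    · simp only [totalIO, List.map_cons, List.sum_cons, MemOp.ioCost] at h5 ⊢
      omega

theorem exists_writes (a : ℕ) (l : List V) (s : MemState V)
    (h : ∀ v ∈ l, v ∈ s.cache) (hM : s.cache.card ≤ M) {κ : ℕ}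
    (hκ : l.length ≤ κ * B) :
    ∃ ops, LegalRun G M B s ops ∧ (runOps s ops).cache = s.cache ∧
      (∀ x, (x < a ∨ a + l.length ≤ x) → (runOps s ops).slow x = s.slow x) ∧
      (∀ t < l.length, (runOps s ops).slow (a + t) = l[t]?) ∧
      computedList ops = [] ∧ totalIO ops ≤ κ := by
  induction κ generalizing a l s with
  | zero =>
    obtain rfl : l = [] := by simpa using hκ
    exact ⟨[], trivial, rfl, fun _ _ => rfl, by simp, rfl, by simp [totalIO]⟩
  | succ κ ih =>
    obtain ⟨ops, h1, h2, h3, h4, h5, h6⟩ := ih (a + (l.take B).length) (l.drop B)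
      (MemOp.apply s (.write a (l.take B))) (fun v hv => h v (List.mem_of_mem_drop hv)) hM
      (by rw [List.length_drop]; rw [add_mul] at hκ; omega)
    have hlen : (l.take B).length + (l.drop B).length = l.length := by
      simp
      omega
    refine ⟨.write a (l.take B) :: ops,
      ⟨⟨List.length_take_le B l, fun v hv => h v (List.mem_of_mem_take hv)⟩, hM, h1⟩,
      h2, fun x hx => ?_, fun t ht => ?_, h5, ?_⟩
    · rw [runOps_cons, h3 x (by omega)]
      simp only [MemOp.apply]
      rw [if_neg (by omega)]
    · rw [runOps_cons]
      by_cases htB : t < (l.take B).length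
      · rw [h3 _ (by omega)]
        simp only [MemOp.apply]
        rw [if_pos (by omega), Nat.add_sub_cancel_left,
          List.getElem?_take_of_lt (htB.trans_le (List.length_take_le B l))]
      · have := h4 (t - (l.take B).length) (by omega)
        rw [show a + t = a + (l.take B).length + (t - (l.take B).length) by omega, this,
          List.getElem?_drop]
        congr 1
        simp only [List.length_take, List.length_drop] at *
        omega
    · simp only [totalIO, List.map_cons, List.sum_cons, MemOp.ioCost] at h6 ⊢
      omega

theorem Reach.load {C : Finset V} {S : Set Γ} {D : Set V} {g : Γ} (hg : g ∈ S) {κ : ℕ}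
    (hκ : (Λ.items g).length ≤ κ * B) (hM : (C ∪ (Λ.items g).toFinset).card ≤ M) :
    Reach G M B Λ ⟨C, S, D⟩ ⟨C ∪ (Λ.items g).toFinset, S, D⟩ κ := by
  refine ⟨subset_rfl, fun s hs hsl => ?_⟩
  obtain ⟨ops, h1, h2, h3, h4, h5⟩ := exists_reads (G := G) (M := M) (Λ.base g) (Λ.items g) s
    (hsl g hg) (by rw [hs]; exact hM) hκ
  exact ⟨ops, h1, by rw [h2, hs], by rwa [h3], by simp [h4], by simp [h4], h5⟩

theorem Reach.save {C : Finset V} {S : Set Γ} {D : Set V} {g : Γ}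
    (hg : ∀ g' ∈ S, g' ≠ g → Λ.Apart g' g) (hC : ∀ v ∈ Λ.items g, v ∈ C) {κ : ℕ}
    (hκ : (Λ.items g).length ≤ κ * B) (hM : C.card ≤ M) :
    Reach G M B Λ ⟨C, S, D⟩ ⟨C, insert g S, D⟩ κ := by
  refine ⟨subset_rfl, fun s hs hsl => ?_⟩
  obtain ⟨ops, h1, h2, h3, h4, h5, h6⟩ := exists_writes (G := G) (M := M) (Λ.base g)
    (Λ.items g) s (hs ▸ hC) (by rw [hs]; exact hM) hκ
  refine ⟨ops, h1, by rw [h2, hs], fun g' hg' => ?_, by simp [h5], by simp [h5], h6⟩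
  by_cases he : g' = g
  · rw [he]
    exact h4
  · have hS := hg'.resolve_left he
    intro t ht
    rw [h3, hsl g' hS t ht]
    rcases hg g' hS he with h | h <;> omega

theorem Reach.ioComplexityNR_le {init : ℕ → Option V} {S : Set Γ} {τ : BlockState V Γ} {w : ℕ}
    (h : Reach G M B Λ ⟨∅, S, ∅⟩ τ w) (hS : ∀ g ∈ S, Λ.Holds init g)
    (ho : ∀ v ∈ G.outputs, ∃ g ∈ τ.saved, v ∈ Λ.items g) : ioComplexityNR G init M B ≤ w := by
  obtain ⟨ops, h1, h2, h3, h4, h5, h6⟩ := h.2 ⟨∅, init⟩ rfl hS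
  refine (iInf₂_le ops ⟨h1, h4, fun v hv => ?_⟩).trans (by exact_mod_cast h6)
  obtain ⟨g, hg, hvg⟩ := ho v hv
  obtain ⟨t, ht⟩ := List.mem_iff_getElem?.1 hvg
  exact ⟨_, (h3 g hg t (List.getElem?_eq_some_iff.1 ht).1).trans ht⟩

end Reach

/-! ### The order of the split positions -/

/-- The left comb with given nonempty sequence of leaves. -/
def AggTree.comb : List ℕ → AggTree
  | [] => .leaf 0
  | k :: l => l.foldl (fun t m => .node t (.leaf m)) (.leaf k)

theorem AggTree.comb_append {l : List ℕ} (hl : l ≠ []) (k : ℕ) :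
    comb (l ++ [k]) = .node (comb l) (.leaf k) := by
  cases l with
  | nil => exact absurd rfl hl
  | cons m l => simp [comb]

theorem AggTree.leaves_comb {l : List ℕ} (hl : l ≠ []) : (comb l).leaves = l := by
  induction l using List.reverseRecOn with
  | nil => exact absurd rfl hl
  | append_singleton l k ih =>
    rcases eq_or_ne l [] with rfl | h
    · rfl
    · rw [comb_append h, leaves, ih h, leaves]

/-- In a left comb every partial minimum runs over a prefix of the order, so a subproblem in
progress needs a single word of cache. -/
theorem AggTree.isSubtree_comb_iff {l : List ℕ} (hl : l ≠ []) {t : AggTree} :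
    t.IsSubtree (comb l) ↔ (∃ k ∈ l, t = .leaf k) ∨ ∃ l', l' <+: l ∧ l' ≠ [] ∧ t = comb l' := by
  induction l using List.reverseRecOn with
  | nil => exact absurd rfl hl
  | append_singleton l k ih =>
    rcases eq_or_ne l [] with rfl | h
    · simp only [List.nil_append, List.mem_singleton, exists_eq_left, comb, List.foldl_nil,
        IsSubtree]
      refine ⟨Or.inl, ?_⟩
      rintro (h | ⟨l', h1, h2, rfl⟩)
      · exact h
      · rcases List.prefix_concat_iff.1 (show l' <+: [] ++ [k] from h1) with rfl | h1
        · rfl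
        · exact absurd (List.prefix_nil.1 h1) h2
    · rw [comb_append h, IsSubtree, ih h]
      constructor
      · rintro (rfl | (⟨m, hm, rfl⟩ | ⟨l', h1, h2, rfl⟩) | ht)
        · exact Or.inr ⟨_, List.prefix_rfl, by simp, (comb_append h k).symm⟩
        · exact Or.inl ⟨m, by simp [hm], rfl⟩
        · exact Or.inr ⟨l', h1.trans (List.prefix_append _ _), h2, rfl⟩
        · exact Or.inl ⟨k, by simp, ht⟩
      · rintro (⟨m, hm, rfl⟩ | ⟨l', h1, h2, rfl⟩)
        · rcases List.mem_append.1 hm with hm | hm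
          · exact Or.inr (Or.inl (Or.inl ⟨m, hm, rfl⟩))
          · rw [List.mem_singleton.1 hm]
            exact Or.inr (Or.inr rfl)
        · rcases List.prefix_concat_iff.1 h1 with rfl | h1
          · exact Or.inl (comb_append h k)
          · exact Or.inr (Or.inl (Or.inr ⟨l', h1, h2, rfl⟩))

/-- The numbers strictly between `a` and `j`, in such an order that, for every `t`, those outside
the blocks of length `2 ^ t` of `a` and `j` come first, block by block. -/
def splitOrder (a j : ℕ) : List ℕ :=
  if a / 2 < j / 2 then
    (splitOrder (a / 2) (j / 2)).flatMap (fun K => List.range' (K * 2) 2) ++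
      ((if a % 2 = 0 then [a + 1] else []) ++ (if j % 2 = 1 then [j - 1] else []))
  else []
termination_by j

theorem mem_flatMap_blocks {b : ℕ} (hb : 0 < b) {l : List ℕ} {k : ℕ} :
    k ∈ l.flatMap (fun K => List.range' (K * b) b) ↔ k / b ∈ l := by
  simp only [List.mem_flatMap, List.mem_range'_1]
  constructor
  · rintro ⟨K, hK, h1, h2⟩
    rwa [Nat.div_eq_of_lt_le h1 (by rw [add_mul, one_mul]; exact h2)]
  · exact fun h => ⟨_, h, Nat.div_mul_le_self _ _, Nat.lt_div_mul_add hb⟩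

/-- Numbers strictly between a and j lie in a pair {2K, 2K + 1} strictly between those of a and j,
or are the other member of an end pair: a + 1 for even a, j - 1 for odd j. -/
theorem mem_splitOrder {a j k : ℕ} : k ∈ splitOrder a j ↔ a < k ∧ k < j := by
  induction j using Nat.strong_induction_on generalizing a k with
  | _ j ih =>
    rw [splitOrder]
    split_ifs with h h1 h2 h2
    all_goals
      first
      | rw [List.mem_append, mem_flatMap_blocks two_pos, ih (j / 2) (by omega)]
      | skip
      simp
      omega

theorem nodup_splitOrder (a j : ℕ) : (splitOrder a j).Nodup := by
  induction j using Nat.strong_induction_on generalizing a with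
  | _ j ih =>
    rw [splitOrder]
    by_cases h : a / 2 < j / 2
    · rw [if_pos h, List.nodup_append', List.nodup_flatMap]
      refine ⟨⟨fun K _ => List.nodup_range', ?_⟩, ?_, ?_⟩
      · refine (ih (j / 2) (by omega) (a / 2)).imp ?_
        intro K K' hK x hx hx'
        simp only [List.mem_range'_1] at hx hx'
        omega
      · split_ifs <;> simp
        omega
      · intro x hx hx'
        rw [mem_flatMap_blocks two_pos, mem_splitOrder] at hx
        split_ifs at hx' <;> simp at hx' <;> omega
    · rw [if_neg h]
      exact List.nodup_nil

/-- Unfold one more level of the recursion at each step: a block of length 2^(t+1) is two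
consecutive blocks of length 2^t, and what the finer level adds joins the remainder `l`. This makes
one choice of trees serve all tile sizes. -/
theorem splitOrder_eq_append (t a j : ℕ) : ∃ l, splitOrder a j =
    (splitOrder (a / 2 ^ t) (j / 2 ^ t)).flatMap (fun K => List.range' (K * 2 ^ t) (2 ^ t)) ++
      l := by
  induction t with
  | zero => exact ⟨[], by simp⟩
  | succ t ih =>
    obtain ⟨l, hl⟩ := ih
    have hd : ∀ x, x / 2 ^ (t + 1) = x / 2 ^ t / 2 := fun x => by
      rw [pow_succ, Nat.div_div_eq_div_mul]
    rw [hd, hd]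
    rw [splitOrder.eq_def (a / 2 ^ t)] at hl
    by_cases h : a / 2 ^ t / 2 < j / 2 ^ t / 2
    · rw [if_pos h] at hl
      simp only [List.flatMap_append, List.append_assoc, List.flatMap_assoc] at hl
      refine ⟨_, hl.trans (congrArg₂ _ (List.flatMap_congr fun K _ => ?_) rfl)⟩
      simp only [List.range', List.flatMap_cons, List.flatMap_nil, List.append_nil]
      rw [show (K * 2 + 1) * 2 ^ t = K * 2 * 2 ^ t + 2 ^ t by ring, List.range'_append_1,
        pow_succ]
      congr 1 <;> ring
    · refine ⟨l, ?_⟩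
      rw [if_neg h] at hl
      rw [hl, splitOrder.eq_def (a / 2 ^ t / 2), if_neg (by omega)]
      rfl

/-- The trees along which the minima are taken: combs in the order `splitOrder`. -/
def combTrees (n : ℕ) : AggTrees n where
  tree i j := .comb (splitOrder (i - 1) j)
  leaves_perm i j hi hij hj := by
    have hm : i ∈ splitOrder (i - 1) j := by rw [mem_splitOrder]; omega
    rw [AggTree.leaves_comb (List.ne_nil_of_mem hm),
      List.perm_ext_iff_of_nodup (nodup_splitOrder _ _) (List.Ico.nodup _ _)]
    intro k
    rw [mem_splitOrder, List.Ico.mem]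
    omega

/-! ### Evaluating the splits of a tile -/

/-- The vertex of `S(a + 1, j)`. -/
def sVertex (n a j : ℕ) : BSTVertex := rootVertex (combTrees n) (a + 1) j

theorem sVertex_eq_q {n a j : ℕ} (h : a + 1 = j) : sVertex n a j = .q j := by
  simp [sVertex, rootVertex, h]

theorem sVertex_eq_agg {n a j : ℕ} (h : a + 1 < j) :
    sVertex n a j = .agg (a + 1) j (.comb (splitOrder a j)) := by
  simp [sVertex, rootVertex, h.ne, combTrees]

/-- The partial minimum over the splits in the list `l`, as a set of at most one value. -/
def accSet (p : ℕ × ℕ) (l : List ℕ) : Finset BSTVertex :=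
  if l = [] then ∅ else {.agg (p.1 + 1) p.2 (.comb l)}

theorem card_accSet_le (p : ℕ × ℕ) (l : List ℕ) : (accSet p l).card ≤ 1 := by
  unfold accSet
  split_ifs <;> simp

/-- The partial minima of the subproblem `p` over subsets of `l`. -/
def splitValues (p : ℕ × ℕ) (l : List ℕ) : Set BSTVertex :=
  {v | ∃ t, v = .agg (p.1 + 1) p.2 t ∧ ∀ m ∈ t.leaves, m ∈ l}

section Sweep

variable {n M B : ℕ} {Γ : Type} {Λ : Layout BSTVertex Γ} {S : Set Γ}

/-- The three spare words hold the old partial minimum, the new candidate and the new partial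
minimum. By `hD` earlier values involve only splits in `l`, so nothing is recomputed. -/
theorem reach_split {p : ℕ × ℕ} (hn : p.2 ≤ n) {l : List ℕ} {k : ℕ}
    (hl : l ++ [k] <+: splitOrder p.1 p.2) {X : Finset BSTVertex} {D : Set BSTVertex}
    (h1 : sVertex n p.1 k ∈ X) (h2 : sVertex n k p.2 ∈ X) (h3 : cumVertex (p.1 + 1) p.2 ∈ X)
    (hM : X.card + 3 ≤ M) (hD : ∀ t, .agg (p.1 + 1) p.2 t ∈ D → ∀ m ∈ t.leaves, m ∈ l) :
    Reach (bstCDAG (combTrees n)) M B Λ ⟨X ∪ accSet p l, S, D⟩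
      ⟨X ∪ accSet p (l ++ [k]), S, D ∪ splitValues p (l ++ [k])⟩ 0 := by
  have hk : k ∈ splitOrder p.1 p.2 := hl.subset (by simp)
  have hk' := mem_splitOrder.1 hk
  have hkl : k ∉ l := by
    have := (nodup_splitOrder p.1 p.2).sublist hl.sublist
    rw [List.nodup_append'] at this
    exact fun h => this.2.2 h (by simp)
  have hleaf : IsBSTVertex (combTrees n) (.agg (p.1 + 1) p.2 (.leaf k)) :=
    isBSTVertex_leaf _ (by omega) (by omega) hk'.2 hn
  have hc := card_accSet_le p l
  have hc' := Finset.card_union_le X (accSet p l)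
  have hi := Finset.card_insert_le (.agg (p.1 + 1) p.2 (.leaf k)) (X ∪ accSet p l)
  have r1 : Reach (bstCDAG (combTrees n)) M B Λ ⟨X ∪ accSet p l, S, D⟩
      ⟨insert (.agg (p.1 + 1) p.2 (.leaf k)) (X ∪ accSet p l), S,
        insert (.agg (p.1 + 1) p.2 (.leaf k)) D⟩ 0 := by
    refine Reach.compute hleaf ?_ ?_ (fun h => hkl (hD _ h k (by simp [AggTree.leaves])))
      (by omega)
    · simp [bstCDAG, bstPre]
    · intro x hx
      simp only [bstCDAG, bstPre, Finset.mem_insert, Finset.mem_singleton] at hx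
      rw [Finset.mem_union]
      rcases hx with rfl | rfl | rfl
      · exact Or.inl h1
      · exact Or.inl h2
      · exact Or.inl h3
  -- For the first split the candidate already is the partial minimum, so no second computation
  -- takes place.
  rcases eq_or_ne l [] with rfl | hne
  · refine (r1.trans (Reach.discard ?_ subset_rfl ?_ (by omega))).mono le_rfl
    · simp [accSet, AggTree.comb]
    · rintro x (rfl | hx)
      · exact Or.inr ⟨_, rfl, by simp [AggTree.leaves]⟩
      · exact Or.inl hx
  · have hcomb := AggTree.comb_append hne k
    have hmem : AggTree.leaves (.comb (l ++ [k])) = l ++ [k] := AggTree.leaves_comb (by simp)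
    have hi' := Finset.card_insert_le (.agg (p.1 + 1) p.2 (.comb (l ++ [k])))
      (insert (.agg (p.1 + 1) p.2 (.leaf k)) (X ∪ accSet p l))
    refine (r1.trans ((Reach.compute (v := .agg (p.1 + 1) p.2 (.comb (l ++ [k]))) ?_ ?_ ?_ ?_
      (by omega)).trans (Reach.discard ?_ subset_rfl ?_ (by omega)))).mono le_rfl
    · refine ⟨hleaf.1, hleaf.2.1, hn, ?_⟩
      exact (AggTree.isSubtree_comb_iff (List.ne_nil_of_mem hk)).2
        (Or.inr ⟨_, hl, by simp, rfl⟩)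
    · simp [hcomb, bstCDAG, bstPre]
    · intro x hx
      simp only [hcomb, bstCDAG, bstPre, Finset.mem_insert, Finset.mem_singleton] at hx
      rcases hx with rfl | rfl
      · simp [accSet, hne]
      · simp
    · rintro (h | h)
      · rw [hcomb] at h
        simp at h
      · exact hkl (hD _ h k (by simp [hmem]))
    · intro x hx
      simp only [accSet, Finset.mem_union, Finset.mem_insert] at hx ⊢
      simp at hx
      tauto
    · rintro x (rfl | rfl | hx)
      · exact Or.inr ⟨_, rfl, by simp [hmem]⟩
      · exact Or.inr ⟨_, rfl, by simp [AggTree.leaves]⟩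
      · exact Or.inl hx

theorem splitValues_mono {p : ℕ × ℕ} {l l' : List ℕ} (h : l ⊆ l') :
    splitValues p l ⊆ splitValues p l' := by
  rintro x ⟨t, rfl, ht⟩
  exact ⟨t, rfl, fun m hm => h (ht m hm)⟩

theorem reach_splits {p : ℕ × ℕ} (hn : p.2 ≤ n) {l ks : List ℕ}
    (hl : l ++ ks <+: splitOrder p.1 p.2) {X : Finset BSTVertex} {D : Set BSTVertex}
    (h12 : ∀ k ∈ ks, sVertex n p.1 k ∈ X ∧ sVertex n k p.2 ∈ X)
    (h3 : cumVertex (p.1 + 1) p.2 ∈ X)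
    (hM : X.card + 3 ≤ M) (hD : ∀ t, .agg (p.1 + 1) p.2 t ∈ D → ∀ m ∈ t.leaves, m ∈ l) :
    Reach (bstCDAG (combTrees n)) M B Λ ⟨X ∪ accSet p l, S, D⟩
      ⟨X ∪ accSet p (l ++ ks), S, D ∪ splitValues p (l ++ ks)⟩ 0 := by
  induction ks generalizing l D with
  | nil =>
    rw [List.append_nil]
    have := card_accSet_le p l
    have := Finset.card_union_le X (accSet p l)
    exact Reach.discard subset_rfl subset_rfl Set.subset_union_left (by omega)
  | cons k ks ih =>
    have e : l ++ k :: ks = l ++ [k] ++ ks := by simp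
    rw [e] at hl ⊢
    have r1 := reach_split (Λ := Λ) (S := S) (B := B) hn ((List.prefix_append _ _).trans hl)
      (h12 k (by simp)).1 (h12 k (by simp)).2 h3 hM hD
    have r2 := ih (D := D ∪ splitValues p (l ++ [k])) hl
      (fun m hm => h12 m (List.mem_cons_of_mem _ hm)) (by
        rintro t (h | ⟨t', h, h'⟩) m hm
        · exact List.mem_append_left _ (hD t h m hm)
        · simp only [BSTVertex.agg.injEq, true_and] at h
          exact h' m (h ▸ hm))
    refine ((r1.trans r2).weaken subset_rfl ?_).mono le_rfl
    rw [Set.union_assoc]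
    refine Set.union_subset_union_right _ (Set.union_subset ?_ subset_rfl)
    exact splitValues_mono (List.subset_append_left _ _)

/-- The partial minima of the subproblems in `ps` over the splits given by `f`. -/
def accSets (f : ℕ × ℕ → List ℕ) (ps : List (ℕ × ℕ)) : Finset BSTVertex :=
  ps.toFinset.biUnion fun p => accSet p (f p)

theorem accSets_cons (f : ℕ × ℕ → List ℕ) (p : ℕ × ℕ) (ps : List (ℕ × ℕ)) :
    accSets f (p :: ps) = accSet p (f p) ∪ accSets f ps := by
  simp [accSets]

theorem card_accSets_le (f : ℕ × ℕ → List ℕ) (ps : List (ℕ × ℕ)) :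
    (accSets f ps).card ≤ ps.length := by
  refine (Finset.card_biUnion_le_card_mul _ _ 1 fun p _ => card_accSet_le _ _).trans ?_
  rw [mul_one]
  exact List.toFinset_card_le ps

/-- The values computed when the splits given by `f` are evaluated for the subproblems in `ps`. -/
def splitsValues (f : ℕ × ℕ → List ℕ) (ps : List (ℕ × ℕ)) : Set BSTVertex :=
  {v | ∃ p ∈ ps, v ∈ splitValues p (f p)}

theorem mem_splitsValues_agg {f : ℕ × ℕ → List ℕ} {ps : List (ℕ × ℕ)} {p : ℕ × ℕ} {t : AggTree}
    (h : .agg (p.1 + 1) p.2 t ∈ splitsValues f ps) : p ∈ ps ∧ ∀ m ∈ t.leaves, m ∈ f p := by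
  obtain ⟨p', hp', t', he, ht⟩ := h
  simp only [BSTVertex.agg.injEq, Nat.add_right_cancel_iff] at he
  obtain rfl : p = p' := Prod.ext he.1 he.2.1
  exact ⟨hp', he.2.2 ▸ ht⟩

/-- `hop` lets a subproblem use the updated values of those before it in the list, as the last stage
of a tile requires. In the induction each updated value passes into `Y`, which leaves `Y.card +
ps.length` bounded as before. -/
theorem reach_sweep {f₀ f₁ : ℕ × ℕ → List ℕ} {ps : List (ℕ × ℕ)} (hps : ps.Nodup)
    {Y : Finset BSTVertex} {D : Set BSTVertex} (hn : ∀ p ∈ ps, p.2 ≤ n)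
    (hf : ∀ p ∈ ps, (∃ ks, f₁ p = f₀ p ++ ks) ∧ f₁ p <+: splitOrder p.1 p.2)
    (hop : ∀ ps₁ p ps₂, ps = ps₁ ++ p :: ps₂ → ∀ k ∈ f₁ p, k ∉ f₀ p →
      sVertex n p.1 k ∈ Y ∪ accSets f₁ ps₁ ∧ sVertex n k p.2 ∈ Y ∪ accSets f₁ ps₁)
    (hcum : ∀ p ∈ ps, cumVertex (p.1 + 1) p.2 ∈ Y)
    (hM : Y.card + ps.length + 3 ≤ M)
    (hD : ∀ p ∈ ps, ∀ t, .agg (p.1 + 1) p.2 t ∈ D → ∀ m ∈ t.leaves, m ∈ f₀ p) :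
    Reach (bstCDAG (combTrees n)) M B Λ ⟨Y ∪ accSets f₀ ps, S, D⟩
      ⟨Y ∪ accSets f₁ ps, S, D ∪ splitsValues f₁ ps⟩ 0 := by
  induction ps generalizing Y D with
  | nil =>
    refine Reach.discard (by simp [accSets]) subset_rfl Set.subset_union_left ?_
    simp [accSets] at hM ⊢
    omega
  | cons p ps ih =>
    rw [List.nodup_cons] at hps
    obtain ⟨⟨ks, hks⟩, hpre⟩ := hf p (by simp)
    have hnd := (nodup_splitOrder p.1 p.2).sublist hpre.sublist
    rw [hks, List.nodup_append'] at hnd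
    have c1 := Finset.card_union_le Y (accSets f₀ ps)
    have c2 := card_accSets_le f₀ ps
    have c3 := Finset.card_union_le Y (accSet p (f₁ p))
    have c4 := card_accSet_le p (f₁ p)
    rw [List.length_cons] at hM
    have hop0 : ∀ k ∈ ks, sVertex n p.1 k ∈ Y ∧ sVertex n k p.2 ∈ Y := fun k hk => by
      simpa [accSets] using hop [] p ps rfl k (by simp [hks, hk])
        (fun h => hnd.2.2 h hk)
    have r1 := reach_splits (Λ := Λ) (S := S) (B := B) (M := M) (X := Y ∪ accSets f₀ ps) (D := D)
      (hn p (by simp)) (hks ▸ hpre)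
      (fun k hk => ⟨Finset.mem_union_left _ (hop0 k hk).1, Finset.mem_union_left _ (hop0 k hk).2⟩)
      (Finset.mem_union_left _ (hcum p (by simp))) (by omega) (hD p (by simp))
    rw [← hks] at r1
    have r2 := ih hps.2 (Y := Y ∪ accSet p (f₁ p)) (D := D ∪ splitValues p (f₁ p))
      (fun p' hp' => hn p' (List.mem_cons_of_mem _ hp'))
      (fun p' hp' => hf p' (List.mem_cons_of_mem _ hp'))
      (fun ps₁ p' ps₂ he k h1 h2 => by
        have := hop (p :: ps₁) p' ps₂ (by rw [he]; rfl) k h1 h2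
        rwa [accSets_cons, ← Finset.union_assoc] at this)
      (fun p' hp' => Finset.mem_union_left _ (hcum p' (List.mem_cons_of_mem _ hp'))) (by omega)
      (by
        rintro p' hp' t (h | ⟨t', h, _⟩)
        · exact hD p' (List.mem_cons_of_mem _ hp') t h
        · simp only [BSTVertex.agg.injEq, Nat.add_right_cancel_iff] at h
          exact absurd (Prod.ext h.1 h.2.1 ▸ hp') hps.1)
    have e0 : Y ∪ accSets f₀ (p :: ps) = Y ∪ accSets f₀ ps ∪ accSet p (f₀ p) := by
      rw [accSets_cons, Finset.union_right_comm, Finset.union_assoc]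
    have e1 : Y ∪ accSet p (f₁ p) ∪ accSets f₀ ps = Y ∪ accSets f₀ ps ∪ accSet p (f₁ p) :=
      Finset.union_right_comm _ _ _
    have e2 : Y ∪ accSets f₁ (p :: ps) = Y ∪ accSet p (f₁ p) ∪ accSets f₁ ps := by
      rw [accSets_cons, Finset.union_assoc]
    rw [e1] at r2
    rw [e0, e2]
    refine ((r1.trans r2).weaken subset_rfl ?_).mono le_rfl
    rintro x ((h | h) | ⟨p', hp', h⟩)
    · exact Or.inl h
    · exact Or.inr ⟨p, by simp, h⟩
    · exact Or.inr ⟨p', List.mem_cons_of_mem _ hp', h⟩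

/-- The vertices of `C(a + 1, j)` for the pairs `(a, j)` of a list. -/
def cumSet (ps : List (ℕ × ℕ)) : Finset BSTVertex :=
  (ps.map fun p => cumVertex (p.1 + 1) p.2).toFinset

theorem reach_cum {ps : List (ℕ × ℕ)} (hps : ps.Nodup) {Y : Finset BSTVertex}
    {D : Set BSTVertex} (hn : ∀ p ∈ ps, p.1 < p.2 ∧ p.2 ≤ n)
    (hq : ∀ p ∈ ps, .q p.2 ∈ Y) (hp : ∀ p ∈ ps, p.1 + 1 < p.2 → .p (p.2 - 1) ∈ Y)
    (hop : ∀ ps₁ p ps₂, ps = ps₁ ++ p :: ps₂ → p.1 + 1 < p.2 →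
      cumVertex (p.1 + 1) (p.2 - 1) ∈ Y ∪ cumSet ps₁)
    (hM : Y.card + ps.length ≤ M) (hD : ∀ p ∈ ps, .cum (p.1 + 1) p.2 ∉ D) :
    Reach (bstCDAG (combTrees n)) M B Λ ⟨Y, S, D⟩
      ⟨Y ∪ cumSet ps, S, D ∪ {v | ∃ p ∈ ps, v = .cum (p.1 + 1) p.2}⟩ 0 := by
  induction ps generalizing Y D with
  | nil =>
    exact Reach.discard (by simp [cumSet]) subset_rfl Set.subset_union_left (by simpa using hM)
  | cons p ps ih =>
    rw [List.nodup_cons] at hps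
    have hc := Finset.card_insert_le (cumVertex (p.1 + 1) p.2) Y
    rw [List.length_cons] at hM
    have r1 : Reach (bstCDAG (combTrees n)) M B Λ ⟨Y, S, D⟩
        ⟨insert (cumVertex (p.1 + 1) p.2) Y, S, insert (.cum (p.1 + 1) p.2) D⟩ 0 := by
      obtain ⟨h1, h2⟩ := hn p (by simp)
      -- If `p.1 + 1 = p.2`, then C is the input `q p.2`, already cached, and nothing is computed.
      rcases eq_or_lt_of_le (Nat.succ_le_of_lt h1) with h3 | h3
      · refine Reach.discard ?_ subset_rfl (Set.subset_insert _ _) (by omega)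
        rw [cumVertex, if_pos h3, Finset.insert_subset_iff]
        exact ⟨by simpa [← h3] using hq p (by simp), subset_rfl⟩
      · rw [cumVertex, if_neg h3.ne] at hc ⊢
        refine Reach.compute ⟨by omega, h3, h2⟩ (by simp [bstCDAG, bstPre]) ?_
          (hD p (by simp)) (by omega)
        intro x hx
        simp only [bstCDAG, bstPre, Finset.mem_insert, Finset.mem_singleton] at hx
        rcases hx with rfl | rfl | rfl
        · simpa [cumSet] using hop [] p ps rfl h3
        · exact hp p (by simp) h3
        · exact hq p (by simp)
    have r2 := ih hps.2 (Y := insert (cumVertex (p.1 + 1) p.2) Y)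
      (D := insert (.cum (p.1 + 1) p.2) D)
      (fun p' hp' => hn p' (List.mem_cons_of_mem _ hp'))
      (fun p' hp' => Finset.mem_insert_of_mem (hq p' (List.mem_cons_of_mem _ hp')))
      (fun p' hp' h => Finset.mem_insert_of_mem (hp p' (List.mem_cons_of_mem _ hp') h))
      (fun ps₁ p' ps₂ he h => by
        have := hop (p :: ps₁) p' ps₂ (by rw [he]; rfl) h
        simp only [cumSet, List.map_cons, List.toFinset_cons, Finset.mem_union,
          Finset.mem_insert] at this ⊢
        tauto) (by omega)
      (by
        rintro p' hp' (h | h)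
        · simp only [BSTVertex.cum.injEq, Nat.add_right_cancel_iff] at h
          exact hps.1 (Prod.ext h.1 h.2 ▸ hp')
        · exact hD p' (List.mem_cons_of_mem _ hp') h)
    have e : Y ∪ cumSet (p :: ps) = insert (cumVertex (p.1 + 1) p.2) Y ∪ cumSet ps := by
      simp [cumSet]
    rw [e]
    refine ((r1.trans r2).weaken subset_rfl ?_).mono le_rfl
    rintro x ((rfl | h) | ⟨p', hp', h⟩)
    · exact Or.inr ⟨p, by simp, rfl⟩
    · exact Or.inl h
    · exact Or.inr ⟨p', List.mem_cons_of_mem _ hp', h⟩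

end Sweep

/-! ### The blocked schedule -/

/-- The pairs `a < j ≤ n` with `a` in block `I` and `j` in block `J`, by decreasing `a`, then
increasing `j`. -/
def tilePairs (n b I J : ℕ) : List (ℕ × ℕ) :=
  ((List.range' (I * b) b).reverse.flatMap fun a =>
    (List.range' (J * b) b).map fun j => (a, j)).filter fun p => p.1 < p.2 ∧ p.2 ≤ n

theorem mem_range'_block {b : ℕ} (hb : 0 < b) {I a : ℕ} :
    a ∈ List.range' (I * b) b ↔ a / b = I := by
  rw [List.mem_range'_1]
  constructor
  · rintro ⟨h1, h2⟩
    exact Nat.div_eq_of_lt_le h1 (by rw [add_mul, one_mul]; exact h2)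
  · rintro rfl
    exact ⟨Nat.div_mul_le_self _ _, Nat.lt_div_mul_add hb⟩

theorem mem_tilePairs {n b I J : ℕ} (hb : 0 < b) {p : ℕ × ℕ} :
    p ∈ tilePairs n b I J ↔ p.1 / b = I ∧ p.2 / b = J ∧ p.1 < p.2 ∧ p.2 ≤ n := by
  obtain ⟨a, j⟩ := p
  simp only [tilePairs, List.mem_filter, List.mem_flatMap, List.mem_reverse, List.mem_map,
    mem_range'_block hb, Prod.mk.injEq, decide_eq_true_eq]
  constructor
  · rintro ⟨⟨a', h1, j', h2, rfl, rfl⟩, h3⟩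
    exact ⟨h1, h2, h3⟩
  · rintro ⟨h1, h2, h3⟩
    exact ⟨⟨a, h1, j, h2, rfl, rfl⟩, h3⟩

theorem length_tilePairs_le (n b I J : ℕ) : (tilePairs n b I J).length ≤ b * b := by
  refine (List.length_filter_le _ _).trans ?_
  simp [List.length_flatMap]

theorem pairwise_tilePairs (n b I J : ℕ) : (tilePairs n b I J).Pairwise
    fun p p' => p'.1 < p.1 ∨ p.1 = p'.1 ∧ p.2 < p'.2 := by
  refine List.Pairwise.filter _ (List.pairwise_flatMap.2 ⟨fun a _ => ?_, ?_⟩)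
  · rw [List.pairwise_map]
    exact (List.pairwise_lt_range' (s := _) (n := _)).imp fun h => Or.inr ⟨rfl, h⟩
  · rw [List.pairwise_reverse]
    refine (List.pairwise_lt_range' (s := _) (n := _)).imp ?_
    intro a a' h x hx y hy
    obtain ⟨j, _, rfl⟩ := List.mem_map.1 hx
    obtain ⟨j', _, rfl⟩ := List.mem_map.1 hy
    exact Or.inl h

theorem nodup_tilePairs (n b I J : ℕ) : (tilePairs n b I J).Nodup :=
  (pairwise_tilePairs n b I J).imp fun {p p'} h => by rintro rfl; omega

/-- The operands `(a, k)` and `(k, j)` of a split of `(a, j)` satisfy `k < j` and `a < k`: if they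
lie in the same tile, they come earlier in this order. -/
theorem mem_of_tilePairs_eq_append {n b I J : ℕ} {ps₁ ps₂ : List (ℕ × ℕ)} {p p' : ℕ × ℕ}
    (h : tilePairs n b I J = ps₁ ++ p :: ps₂) (hp' : p' ∈ tilePairs n b I J)
    (hlt : p.1 < p'.1 ∨ p'.1 = p.1 ∧ p'.2 < p.2) : p' ∈ ps₁ := by
  have hw := pairwise_tilePairs n b I J
  rw [h] at hp' hw
  rcases List.mem_append.1 hp' with h1 | h1
  · exact h1
  · rcases List.mem_cons.1 h1 with rfl | h1
    · omega
    · have := List.rel_of_pairwise_cons (List.pairwise_append.1 hw).2.1 h1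
      omega

/-- The groups of the blocked schedule: blocks of inputs and tiles of values of `S` and `C`. -/
inductive TileGroup where
  | p (J : ℕ)
  | q (J : ℕ)
  | s (I J : ℕ)
  | c (I J : ℕ)

/-- The placement of the groups in the slow memory. -/
def tileLayout (n b : ℕ) : Layout BSTVertex TileGroup where
  base
    | .p J => max (J * b - 1) 1 - 1
    | .q J => n - 1 + (max (J * b) 1 - 1)
    | .s I J => 2 * n + 2 * Nat.pair I J * (b * b)
    | .c I J => 2 * n + (2 * Nat.pair I J + 1) * (b * b)
  items
    -- Column block J needs `p (j - 1)` for the j in the block, hence the start at J·b - 1. Input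
    -- groups may overlap; they are never written.
    | .p J => (List.range' (max (J * b - 1) 1)
        (min (max (J * b - 1) 1 + b) n - max (J * b - 1) 1)).map .p
    | .q J => (List.range' (max (J * b) 1)
        (min (max (J * b) 1 + b) (n + 1) - max (J * b) 1)).map .q
    | .s I J => (tilePairs n b I J).map fun p => sVertex n p.1 p.2
    | .c I J => (tilePairs n b I J).map fun p => cumVertex (p.1 + 1) p.2

/-! ### Processing one tile -/

section Tile

variable {n b : ℕ}

theorem length_items_le (g : TileGroup) :
    ((tileLayout n b).items g).length ≤ b * b := by
  have : b ≤ b * b := Nat.le_mul_self b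
  cases g with
  | p J => simp [tileLayout]; omega
  | q J => simp [tileLayout]; omega
  | s I J => simpa [tileLayout] using length_tilePairs_le n b I J
  | c I J => simpa [tileLayout] using length_tilePairs_le n b I J

theorem card_items_le (g : TileGroup) :
    ((tileLayout n b).items g).toFinset.card ≤ b * b :=
  (List.toFinset_card_le _).trans (length_items_le g)

theorem holds_input (g : TileGroup) (hg : (∃ J, g = .p J) ∨ ∃ J, g = .q J) :
    (tileLayout n b).Holds (bstInput n) g := by
  rcases hg with ⟨J, rfl⟩ | ⟨J, rfl⟩
  · intro t ht
    simp only [tileLayout, List.length_map, List.length_range'] at ht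
    change bstInput n (max (J * b - 1) 1 - 1 + t) = (List.map _ (List.range' _ _))[t]?
    rw [bstInput, if_pos (by omega), List.getElem?_map, List.getElem?_range' ht, Option.map_some]
    congr 2
    omega
  · intro t ht
    simp only [tileLayout, List.length_map, List.length_range'] at ht
    change bstInput n (n - 1 + (max (J * b) 1 - 1) + t) = (List.map _ (List.range' _ _))[t]?
    rw [bstInput, if_neg (by omega), if_pos (by omega), List.getElem?_map,
      List.getElem?_range' ht, Option.map_some]
    congr 2
    omega

/-- A number identifying a tile group. -/
def TileGroup.code : TileGroup → ℕ
  | .p _ => 0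
  | .q _ => 0
  | .s I J => 2 * Nat.pair I J
  | .c I J => 2 * Nat.pair I J + 1

/-- The groups consisting of a tile. -/
def TileGroup.IsTile : TileGroup → Prop
  | .p _ => False
  | .q _ => False
  | .s _ _ => True
  | .c _ _ => True

theorem apart_of_ne {g g' : TileGroup} (hg : g.IsTile) (hg' : g'.IsTile)
    (h : g ≠ g') : (tileLayout n b).Apart g g' := by
  have hc : g.code ≠ g'.code := by
    intro he
    cases g <;> cases g' <;> simp only [TileGroup.IsTile] at hg hg' <;>
      simp only [TileGroup.code] at he <;> first | omega | skip
    all_goals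
      simp only [Nat.add_right_cancel_iff, Nat.mul_right_inj two_ne_zero, Nat.pair_eq_pair] at he
      exact h (by rw [he.1, he.2])
  have hbase : ∀ g : TileGroup, g.IsTile → (tileLayout n b).base g = 2 * n + g.code * (b * b) := by
    intro g hg
    cases g <;> simp only [TileGroup.IsTile] at hg <;> rfl
  have h1 := length_items_le (n := n) (b := b) g
  have h2 := length_items_le (n := n) (b := b) g'
  rw [Layout.Apart, hbase g hg, hbase g' hg']
  rcases lt_or_gt_of_ne hc with h3 | h3
  · left
    have := Nat.mul_le_mul_right (b * b) (Nat.succ_le_of_lt h3)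
    rw [Nat.succ_mul] at this
    omega
  · right
    have := Nat.mul_le_mul_right (b * b) (Nat.succ_le_of_lt h3)
    rw [Nat.succ_mul] at this
    omega

/-- The restriction on J matters even for empty groups, whose base address would otherwise run into
the tiles. -/
theorem apart_input (hn : 1 ≤ n) {g g' : TileGroup} (hg' : g'.IsTile)
    (hg : ∃ J, J ≤ n / b ∧ (g = .p J ∨ g = .q J)) : (tileLayout n b).Apart g g' := by
  left
  have h1 : 2 * n ≤ (tileLayout n b).base g' := by
    cases g' <;> simp only [TileGroup.IsTile] at hg' <;> simp [tileLayout]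
  refine le_trans ?_ h1
  obtain ⟨J, hJ, h⟩ := hg
  have h2 : J * b ≤ n := (Nat.mul_le_mul_right b hJ).trans (Nat.div_mul_le_self _ _)
  rcases h with rfl | rfl <;> simp [tileLayout] <;> omega

theorem p_mem_items (hb : 0 < b) {j J : ℕ} (hj : j / b = J) (h2 : 2 ≤ j) (hn : j ≤ n) :
    .p (j - 1) ∈ (tileLayout n b).items (.p J) := by
  have h := (mem_range'_block hb).2 hj
  rw [List.mem_range'_1] at h
  simp only [tileLayout, List.mem_map, List.mem_range'_1]
  exact ⟨j - 1, by omega, rfl⟩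

theorem q_mem_items (hb : 0 < b) {j J : ℕ} (hj : j / b = J) (h1 : 1 ≤ j) (hn : j ≤ n) :
    .q j ∈ (tileLayout n b).items (.q J) := by
  have h := (mem_range'_block hb).2 hj
  rw [List.mem_range'_1] at h
  simp only [tileLayout, List.mem_map, List.mem_range'_1]
  exact ⟨j, by omega, rfl⟩

theorem s_mem_items (hb : 0 < b) {a j I J : ℕ} (hI : a / b = I) (hJ : j / b = J) (h : a < j)
    (hn : j ≤ n) : sVertex n a j ∈ (tileLayout n b).items (.s I J) :=
  List.mem_map.2 ⟨(a, j), (mem_tilePairs hb).2 ⟨hI, hJ, h, hn⟩, rfl⟩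

theorem c_mem_items (hb : 0 < b) {a j I J : ℕ} (hI : a / b = I) (hJ : j / b = J) (h : a < j)
    (hn : j ≤ n) : cumVertex (a + 1) j ∈ (tileLayout n b).items (.c I J) :=
  List.mem_map.2 ⟨(a, j), (mem_tilePairs hb).2 ⟨hI, hJ, h, hn⟩, rfl⟩

/-- The values kept in the cache while a tile is processed. -/
def tileBase (n b I J : ℕ) : Finset BSTVertex :=
  ((tileLayout n b).items (.q J)).toFinset ∪ cumSet (tilePairs n b I J)

theorem card_cumSet_le (ps : List (ℕ × ℕ)) : (cumSet ps).card ≤ ps.length :=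
  (List.toFinset_card_le _).trans (by simp)

theorem card_tileBase_le (I J : ℕ) : (tileBase n b I J).card ≤ 2 * (b * b) := by
  have h1 := card_items_le (n := n) (b := b) (.q J)
  have h2 := (card_cumSet_le _).trans (length_tilePairs_le n b I J)
  have h3 := Finset.card_union_le ((tileLayout n b).items (.q J)).toFinset
    (cumSet (tilePairs n b I J))
  rw [tileBase]
  omega

variable {M B κ : ℕ} {S : Set TileGroup} {D : Set BSTVertex} {I J : ℕ}

/-- Diagonal tiles have no other tile to read; the conditional set `X` lets them share the argument
of the others. -/
theorem reach_load_if (c : Prop) (g : TileGroup) (hκ : b * b ≤ κ * B)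
    {C : Finset BSTVertex} (hM : C.card + b * b ≤ M) (hg : c → g ∈ S) :
    ∃ X, (c → X = ((tileLayout n b).items g).toFinset) ∧ X.card ≤ b * b ∧
      Reach (bstCDAG (combTrees n)) M B (tileLayout n b) ⟨C, S, D⟩ ⟨C ∪ X, S, D⟩ κ := by
  have h1 := card_items_le (n := n) (b := b) g
  by_cases hc : c
  · refine ⟨_, fun _ => rfl, h1, Reach.load (hg hc) ((length_items_le g).trans hκ) ?_⟩
    exact (Finset.card_union_le _ _).trans (by omega)
  · refine ⟨∅, fun h => absurd h hc, by simp, ?_⟩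
    rw [Finset.union_empty]
    exact (Reach.refl _).mono (Nat.zero_le _)

/-- C(i, j) needs only C(i, j - 1), which is in the same tile or in its left neighbour. So four
transfers suffice: the blocks of `p` and `q`, that neighbour, and the result. -/
theorem reach_tile_cum (hb : 0 < b) (hκ : b * b ≤ κ * B) (hM : 16 * (b * b) ≤ M)
    (hp : .p J ∈ S) (hq : .q J ∈ S) (hc : I < J → .c I (J - 1) ∈ S)
    (hS : ∀ g ∈ S, g ≠ .c I J → (tileLayout n b).Apart g (.c I J))
    (hD : ∀ p ∈ tilePairs n b I J, .cum (p.1 + 1) p.2 ∉ D) :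
    Reach (bstCDAG (combTrees n)) M B (tileLayout n b) ⟨∅, S, D⟩
      ⟨tileBase n b I J, insert (.c I J) S,
        D ∪ {v | ∃ p ∈ tilePairs n b I J, v = .cum (p.1 + 1) p.2}⟩ (4 * κ) := by
  set P := ((tileLayout n b).items (.p J)).toFinset with hP
  set Q := ((tileLayout n b).items (.q J)).toFinset with hQ
  have cP : P.card ≤ b * b := card_items_le _
  have cQ : Q.card ≤ b * b := card_items_le _
  have cPQ : (P ∪ Q).card ≤ P.card + Q.card := Finset.card_union_le _ _
  have hlen := length_tilePairs_le n b I J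
  have r1 : Reach (bstCDAG (combTrees n)) M B (tileLayout n b) ⟨∅, S, D⟩ ⟨P, S, D⟩ κ := by
    have := Reach.load (G := bstCDAG (combTrees n)) (M := M) (B := B) (Λ := tileLayout n b)
      (C := ∅) (D := D) hp ((length_items_le _).trans hκ)
      (by rw [Finset.empty_union]; exact (card_items_le _).trans (by omega))
    rwa [Finset.empty_union] at this
  have r2 : Reach (bstCDAG (combTrees n)) M B (tileLayout n b) ⟨P, S, D⟩ ⟨P ∪ Q, S, D⟩ κ :=
    Reach.load hq ((length_items_le _).trans hκ) (by rw [← hQ]; omega)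
  obtain ⟨X, hX, cX, r3⟩ := reach_load_if (n := n) (M := M) (B := B) (D := D) (I < J)
    (.c I (J - 1)) hκ (C := P ∪ Q) (by omega) hc
  have cY : (P ∪ Q ∪ X).card ≤ (P ∪ Q).card + X.card := Finset.card_union_le _ _
  have r4 := reach_cum (M := M) (B := B) (Λ := tileLayout n b) (S := S) (n := n)
    (nodup_tilePairs n b I J) (Y := P ∪ Q ∪ X) (D := D)
    (fun p hp => ((mem_tilePairs hb).1 hp).2.2)
    (fun p hp => by
      obtain ⟨h1, h2, h3, h4⟩ := (mem_tilePairs hb).1 hp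
      have := q_mem_items hb h2 (by omega) h4
      simp [hQ, this])
    (fun p hp hlt => by
      obtain ⟨h1, h2, h3, h4⟩ := (mem_tilePairs hb).1 hp
      have := p_mem_items hb h2 (by omega) h4
      simp [hP, this])
    (fun ps₁ p ps₂ he hlt => by
      obtain ⟨h1, h2, h3, h4⟩ := (mem_tilePairs hb).1 (show p ∈ tilePairs n b I J by simp [he])
      rw [Finset.mem_union]
      have hle : (p.2 - 1) / b ≤ p.2 / b := Nat.div_le_div_right (by omega)
      have hge : p.1 / b ≤ (p.2 - 1) / b := Nat.div_le_div_right (by omega)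
      have hsucc : p.2 / b ≤ (p.2 - 1) / b + 1 := by
        rw [← Nat.add_div_right _ hb]
        exact Nat.div_le_div_right (by omega)
      by_cases hj : (p.2 - 1) / b = J
      · right
        have := mem_of_tilePairs_eq_append (p' := (p.1, p.2 - 1)) he
          ((mem_tilePairs hb).2 ⟨h1, hj, by simp only; omega, by simp only; omega⟩)
          (Or.inr ⟨rfl, by simp only; omega⟩)
        exact List.mem_toFinset.2 (List.mem_map.2 ⟨_, this, rfl⟩)
      · left
        rw [hX (by omega), Finset.mem_union, List.mem_toFinset]
        exact Or.inr (c_mem_items hb h1 (by omega) (by omega) (by omega)))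
    (by omega) hD
  have cZ : (P ∪ Q ∪ X ∪ cumSet (tilePairs n b I J)).card ≤
      (P ∪ Q ∪ X).card + (cumSet (tilePairs n b I J)).card := Finset.card_union_le _ _
  have cC := card_cumSet_le (tilePairs n b I J)
  refine ((((r1.trans r2).trans r3).trans r4).trans ((Reach.save (g := .c I J) (κ := κ) hS ?_
    ((length_items_le _).trans hκ) (by omega)).trans
    (Reach.discard ?_ subset_rfl subset_rfl (by omega)))).mono ?_
  · intro v hv
    exact Finset.mem_union_right _ (List.mem_toFinset.2 hv)
  · rw [tileBase]
    intro x hx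
    simp only [Finset.mem_union] at hx ⊢
    tauto
  · omega

/-- The elements of the blocks in the list `Ks`. -/
def blockList (b : ℕ) (Ks : List ℕ) : List ℕ :=
  Ks.flatMap fun K => List.range' (K * b) b

theorem accSets_nil (ps : List (ℕ × ℕ)) : accSets (fun _ => []) ps = ∅ := by
  ext
  simp [accSets, accSet]

theorem blockList_append (Ks : List ℕ) (K : ℕ) :
    blockList b (Ks ++ [K]) = blockList b Ks ++ List.range' (K * b) b := by
  simp [blockList]

theorem blockList_prefix {t : ℕ} (hb : b = 2 ^ t) {Ks : List ℕ} (h : Ks <+: splitOrder I J)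
    {p : ℕ × ℕ} (hp : p ∈ tilePairs n b I J) : blockList b Ks <+: splitOrder p.1 p.2 := by
  obtain ⟨rfl, rfl, _⟩ := (mem_tilePairs (hb ▸ Nat.two_pow_pos t)).1 hp
  obtain ⟨l, hl⟩ := splitOrder_eq_append t p.1 p.2
  obtain ⟨l', hl'⟩ := h
  rw [hl, ← hb, ← hl', List.flatMap_append, List.append_assoc]
  exact List.prefix_append _ _

/-- For K strictly between I and J, the operands of all splits in block K lie in the finished tiles
(I, K) and (K, J). The block lists are prefixes of the split order of every pair of the tile, so all
partial minima advance together and stay in the cache. -/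
theorem reach_tile_middle {t : ℕ} (hb : b = 2 ^ t) (hκ : b * b ≤ κ * B)
    (hM : 16 * (b * b) ≤ M) (hs : ∀ K, I < K → K < J → .s I K ∈ S ∧ .s K J ∈ S)
    (hD : ∀ p ∈ tilePairs n b I J, ∀ t, .agg (p.1 + 1) p.2 t ∉ D) (Ks : List ℕ)
    (hK : Ks <+: splitOrder I J) :
    Reach (bstCDAG (combTrees n)) M B (tileLayout n b) ⟨tileBase n b I J, S, D⟩
      ⟨tileBase n b I J ∪ accSets (fun _ => blockList b Ks) (tilePairs n b I J), S,
        D ∪ splitsValues (fun _ => blockList b Ks) (tilePairs n b I J)⟩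
      (2 * κ * Ks.length) := by
  have hb0 : 0 < b := hb ▸ Nat.two_pow_pos t
  have hbb : 0 < b * b := Nat.mul_pos hb0 hb0
  set ps := tilePairs n b I J with hps
  set Z := tileBase n b I J with hZ
  have cZ : Z.card ≤ 2 * (b * b) := card_tileBase_le I J
  have hlen : ps.length ≤ b * b := length_tilePairs_le n b I J
  induction Ks using List.reverseRecOn with
  | nil =>
    refine Reach.discard ?_ subset_rfl Set.subset_union_left (by omega)
    simp [blockList, accSets_nil]
  | append_singleton Ks K ih =>
    have hK' : I < K ∧ K < J := mem_splitOrder.1 (hK.subset (by simp))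
    have r0 := ih ((List.prefix_append _ _).trans hK)
    set A₀ := accSets (fun _ => blockList b Ks) ps with hA₀
    have cA₀ : A₀.card ≤ ps.length := card_accSets_le _ _
    set S₁ := ((tileLayout n b).items (.s I K)).toFinset with hS₁
    set S₂ := ((tileLayout n b).items (.s K J)).toFinset with hS₂
    have cS₁ : S₁.card ≤ b * b := card_items_le _
    have cS₂ : S₂.card ≤ b * b := card_items_le _
    have c1 : (Z ∪ A₀).card ≤ Z.card + A₀.card := Finset.card_union_le _ _
    have c2 : (Z ∪ A₀ ∪ S₁).card ≤ (Z ∪ A₀).card + S₁.card := Finset.card_union_le _ _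
    have c3 : (Z ∪ A₀ ∪ S₁ ∪ S₂).card ≤ (Z ∪ A₀ ∪ S₁).card + S₂.card := Finset.card_union_le _ _
    have c4 : (Z ∪ S₁).card ≤ Z.card + S₁.card := Finset.card_union_le _ _
    have c5 : (Z ∪ S₁ ∪ S₂).card ≤ (Z ∪ S₁).card + S₂.card := Finset.card_union_le _ _
    set D₀ := D ∪ splitsValues (fun _ => blockList b Ks) ps with hD₀
    have r1 : Reach (bstCDAG (combTrees n)) M B (tileLayout n b) ⟨Z ∪ A₀, S, D₀⟩
        ⟨Z ∪ A₀ ∪ S₁, S, D₀⟩ κ :=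
      Reach.load (hs K hK'.1 hK'.2).1 ((length_items_le _).trans hκ) (by rw [← hS₁]; omega)
    have r2 : Reach (bstCDAG (combTrees n)) M B (tileLayout n b) ⟨Z ∪ A₀ ∪ S₁, S, D₀⟩
        ⟨Z ∪ A₀ ∪ S₁ ∪ S₂, S, D₀⟩ κ :=
      Reach.load (hs K hK'.1 hK'.2).2 ((length_items_le _).trans hκ) (by rw [← hS₂]; omega)
    have r3 := reach_sweep (M := M) (B := B) (Λ := tileLayout n b) (S := S) (n := n) (ps := ps)
      (f₀ := fun _ => blockList b Ks) (f₁ := fun _ => blockList b (Ks ++ [K]))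
      (nodup_tilePairs n b I J) (Y := Z ∪ S₁ ∪ S₂)
      (D := D₀)
      (fun p hp => ((mem_tilePairs hb0).1 hp).2.2.2)
      (fun p hp => ⟨⟨_, blockList_append Ks K⟩, blockList_prefix hb hK hp⟩)
      (fun ps₁ p ps₂ he k h1 h2 => by
        have hp : p ∈ ps := by simp [he]
        obtain ⟨a1, a2, a3, a4⟩ := (mem_tilePairs hb0).1 hp
        have hk := mem_splitOrder.1 ((blockList_prefix hb hK hp).subset h1)
        rw [blockList_append, List.mem_append] at h1
        have hkK := (mem_range'_block hb0).1 (h1.resolve_left h2)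
        have m1 := s_mem_items (n := n) hb0 a1 hkK hk.1 (by omega)
        have m2 := s_mem_items (n := n) hb0 hkK a2 hk.2 (by omega)
        simp [hS₁, hS₂, m1, m2])
      (fun p hp => by
        simp only [Finset.mem_union]
        refine Or.inl (Or.inl ?_)
        rw [hZ, tileBase, Finset.mem_union]
        exact Or.inr (List.mem_toFinset.2 (List.mem_map.2 ⟨p, hp, rfl⟩)))
      (by omega)
      (by
        rintro p hp t (h | h)
        · exact absurd h (hD p hp t)
        · exact (mem_splitsValues_agg h).2)
    set A₁ := accSets (fun _ => blockList b (Ks ++ [K])) ps with hA₁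
    have cA₁ : A₁.card ≤ ps.length := card_accSets_le _ _
    have c6 : (Z ∪ S₁ ∪ S₂ ∪ A₁).card ≤ (Z ∪ S₁ ∪ S₂).card + A₁.card := Finset.card_union_le _ _
    have e : Z ∪ A₀ ∪ S₁ ∪ S₂ = Z ∪ S₁ ∪ S₂ ∪ A₀ := by
      rw [Finset.union_right_comm Z, Finset.union_right_comm]
    rw [e] at r2
    have r4 := ((r0.trans r1).trans r2).trans r3
    refine (r4.trans (Reach.discard (C' := Z ∪ A₁) ?_ subset_rfl ?_ (by omega))).mono ?_
    · exact Finset.union_subset_union_left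
        (Finset.subset_union_left.trans Finset.subset_union_left)
    · rintro x ((h | ⟨p, hp, h⟩) | h)
      · exact Or.inl h
      · refine Or.inr ⟨p, hp, splitValues_mono ?_ h⟩
        rw [blockList_append]
        exact List.subset_append_left _ _
      · exact Or.inr h
    · rw [List.length_append, List.length_singleton]
      apply le_of_eq
      ring

/-- The remaining splits k lie in block I or block J. One operand is then in the diagonal tile (I,
I) or (J, J), the other in the tile (I, J) itself and already finished by the order of the pairs. If
I = J, both are in the tile itself. -/
theorem reach_tile_final {t : ℕ} (hb : b = 2 ^ t) (hκ : b * b ≤ κ * B)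
    (hM : 16 * (b * b) ≤ M) (hs : I < J → .s I I ∈ S ∧ .s J J ∈ S)
    (hS : ∀ g ∈ S, g ≠ .s I J → (tileLayout n b).Apart g (.s I J))
    (hD : ∀ p ∈ tilePairs n b I J, ∀ t, .agg (p.1 + 1) p.2 t ∈ D →
      ∀ m ∈ t.leaves, m ∈ blockList b (splitOrder I J)) :
    Reach (bstCDAG (combTrees n)) M B (tileLayout n b)
      ⟨tileBase n b I J ∪ accSets (fun _ => blockList b (splitOrder I J)) (tilePairs n b I J),
        S, D⟩
      ⟨∅, insert (.s I J) S,
        D ∪ splitsValues (fun p => splitOrder p.1 p.2) (tilePairs n b I J)⟩ (3 * κ) := by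
  have hb0 : 0 < b := hb ▸ Nat.two_pow_pos t
  have hbb : 0 < b * b := Nat.mul_pos hb0 hb0
  set ps := tilePairs n b I J with hps
  set Z := tileBase n b I J with hZ
  have cZ : Z.card ≤ 2 * (b * b) := card_tileBase_le I J
  have hlen : ps.length ≤ b * b := length_tilePairs_le n b I J
  set A₀ := accSets (fun _ => blockList b (splitOrder I J)) ps with hA₀
  have cA₀ : A₀.card ≤ ps.length := card_accSets_le _ _
  have c1 : (Z ∪ A₀).card ≤ Z.card + A₀.card := Finset.card_union_le _ _
  obtain ⟨S₁, hS₁, cS₁, r1⟩ := reach_load_if (n := n) (M := M) (B := B) (D := D) (I < J)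
    (.s I I) hκ (C := Z ∪ A₀) (by omega) fun h => (hs h).1
  have c2 : (Z ∪ A₀ ∪ S₁).card ≤ (Z ∪ A₀).card + S₁.card := Finset.card_union_le _ _
  obtain ⟨S₂, hS₂, cS₂, r2⟩ := reach_load_if (n := n) (M := M) (B := B) (D := D) (I < J)
    (.s J J) hκ (C := Z ∪ A₀ ∪ S₁) (by omega) fun h => (hs h).2
  have c4 : (Z ∪ S₁).card ≤ Z.card + S₁.card := Finset.card_union_le _ _
  have c5 : (Z ∪ S₁ ∪ S₂).card ≤ (Z ∪ S₁).card + S₂.card := Finset.card_union_le _ _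
  have root : ∀ ps' : List (ℕ × ℕ), ∀ x y, (x, y) ∈ ps' → x < y → y / b = J → y ≤ n →
      sVertex n x y ∈ Z ∪ S₁ ∪ S₂ ∪ accSets (fun p => splitOrder p.1 p.2) ps' := by
    intro ps' x y hxy hlt hy hyn
    -- For y = x + 1 the solution is the input `q y`, which is why the block of `q` stays in the
    -- cache.
    rcases eq_or_lt_of_le (Nat.succ_le_of_lt hlt) with h | h
    · rw [sVertex_eq_q h]
      have := q_mem_items hb0 hy (by omega) hyn
      simp [hZ, tileBase, this]
    · rw [sVertex_eq_agg h]
      refine Finset.mem_union_right _ (Finset.mem_biUnion.2 ⟨(x, y), by simpa using hxy, ?_⟩)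
      have : splitOrder x y ≠ [] :=
        List.ne_nil_of_mem (a := x + 1) (mem_splitOrder.2 ⟨by omega, h⟩)
      simp [accSet, this]
  have r3 := reach_sweep (M := M) (B := B) (Λ := tileLayout n b) (S := S) (n := n) (ps := ps)
    (f₀ := fun _ => blockList b (splitOrder I J)) (f₁ := fun p => splitOrder p.1 p.2)
    (nodup_tilePairs n b I J) (Y := Z ∪ S₁ ∪ S₂) (D := D)
    (fun p hp => ((mem_tilePairs hb0).1 hp).2.2.2)
    (fun p hp => ⟨by
      obtain ⟨l, hl⟩ := blockList_prefix hb List.prefix_rfl hp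
      exact ⟨l, hl.symm⟩, List.prefix_rfl⟩)
    (fun ps₁ p ps₂ he k h1 h2 => by
      obtain ⟨a1, a2, a3, a4⟩ := (mem_tilePairs hb0).1 (show p ∈ tilePairs n b I J by
        rw [← hps, he]; simp)
      have hk := mem_splitOrder.1 h1
      have hle : p.1 / b ≤ k / b := Nat.div_le_div_right hk.1.le
      have hge : k / b ≤ p.2 / b := Nat.div_le_div_right hk.2.le
      have hkb : k / b = I ∨ k / b = J := by
        rw [blockList, mem_flatMap_blocks hb0, mem_splitOrder] at h2
        omega
      constructor
      · by_cases hkJ : k / b = J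
        · refine root ps₁ _ _ (mem_of_tilePairs_eq_append he
            ((mem_tilePairs hb0).2 ⟨a1, hkJ, hk.1, by simp only; omega⟩)
            (Or.inr ⟨rfl, hk.2⟩)) hk.1 hkJ (by omega)
        · have hkI := hkb.resolve_right hkJ
          have := s_mem_items (n := n) hb0 a1 hkI hk.1 (by omega)
          rw [hS₁ (by omega)]
          simp [this]
      · by_cases hkI : k / b = I
        · refine root ps₁ _ _ (mem_of_tilePairs_eq_append he
            ((mem_tilePairs hb0).2 ⟨hkI, a2, hk.2, a4⟩) (Or.inl hk.1)) hk.2 a2 a4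
        · have hkJ := hkb.resolve_left hkI
          have := s_mem_items (n := n) hb0 hkJ a2 hk.2 a4
          rw [hS₂ (by omega)]
          simp [this])
    (fun p hp => by
      simp only [Finset.mem_union]
      refine Or.inl (Or.inl ?_)
      rw [hZ, tileBase, Finset.mem_union]
      exact Or.inr (List.mem_toFinset.2 (List.mem_map.2 ⟨p, hp, rfl⟩)))
    (by omega) hD
  set A₁ := accSets (fun p => splitOrder p.1 p.2) ps with hA₁
  have cA₁ : A₁.card ≤ ps.length := card_accSets_le _ _
  have c6 : (Z ∪ S₁ ∪ S₂ ∪ A₁).card ≤ (Z ∪ S₁ ∪ S₂).card + A₁.card := Finset.card_union_le _ _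
  have e : Z ∪ A₀ ∪ S₁ ∪ S₂ = Z ∪ S₁ ∪ S₂ ∪ A₀ := by
    rw [Finset.union_right_comm Z, Finset.union_right_comm]
  rw [e] at r2
  refine (((r1.trans r2).trans r3).trans ((Reach.save (g := .s I J) (κ := κ) hS ?_
    ((length_items_le _).trans hκ) (by omega)).trans
    (Reach.discard (Finset.empty_subset _) subset_rfl subset_rfl (by omega)))).mono ?_
  · intro v hv
    obtain ⟨⟨x, y⟩, hp, rfl⟩ := List.mem_map.1 hv
    obtain ⟨a1, a2, a3, a4⟩ := (mem_tilePairs hb0).1 hp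
    exact root ps x y hp a3 a2 a4
  · omega

end Tile

/-- The tile `(I', J')` is processed before the tile `(I, J)`. -/
def TileBefore (n b I J I' J' : ℕ) : Prop :=
  (I < I' ∨ I' = I ∧ J' < J) ∧ I' ≤ J' ∧ J' ≤ n / b

/-- The groups stored before the tile `(I, J)` is processed. -/
def savedBefore (n b I J : ℕ) : Set TileGroup := fun g =>
  match g with
  | .p J' => J' ≤ n / b
  | .q J' => J' ≤ n / b
  | .s I' J' => TileBefore n b I J I' J'
  | .c I' J' => TileBefore n b I J I' J'

/-- The vertices of the tiles before the tile `(I, J)`. -/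
def doneBefore (b I J : ℕ) : Set BSTVertex :=
  {v | ∃ a j, (I < a / b ∨ a / b = I ∧ j / b < J) ∧
    (v = .cum (a + 1) j ∨ ∃ t, v = .agg (a + 1) j t)}

/-! ### Running through the tiles by decreasing row, then increasing column -/

section Schedule

variable {n b t M B κ : ℕ}

theorem cum_mem_doneBefore {I J a j : ℕ} :
    .cum (a + 1) j ∈ doneBefore b I J ↔ I < a / b ∨ a / b = I ∧ j / b < J := by
  constructor
  · rintro ⟨a', j', h, h' | ⟨t, h'⟩⟩
    · simp only [BSTVertex.cum.injEq, Nat.add_right_cancel_iff] at h'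
      rwa [h'.1, h'.2]
    · simp at h'
  · exact fun h => ⟨a, j, h, Or.inl rfl⟩

theorem agg_mem_doneBefore {I J a j : ℕ} {t : AggTree} :
    .agg (a + 1) j t ∈ doneBefore b I J ↔ I < a / b ∨ a / b = I ∧ j / b < J := by
  constructor
  · rintro ⟨a', j', h, h' | ⟨t, h'⟩⟩
    · simp at h'
    · simp only [BSTVertex.agg.injEq, Nat.add_right_cancel_iff] at h'
      rwa [h'.1, h'.2.1]
  · exact fun h => ⟨a, j, h, Or.inr ⟨t, rfl⟩⟩

theorem length_splitOrder_le (a j : ℕ) : (splitOrder a j).length ≤ j := by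
  have h : (splitOrder a j).toFinset ⊆ Finset.range j := fun k hk => by
    rw [List.mem_toFinset, mem_splitOrder] at hk
    simpa using hk.2
  have := Finset.card_le_card h
  rwa [List.toFinset_card_of_nodup (nodup_splitOrder a j), Finset.card_range] at this

theorem apart_savedBefore (hn : 1 ≤ n) {I J : ℕ} {g g' : TileGroup} (hg' : g'.IsTile)
    (hg : g ∈ savedBefore n b I J) (h : g ≠ g') : (tileLayout n b).Apart g g' := by
  cases g with
  | p K => exact apart_input hn hg' ⟨K, hg, Or.inl rfl⟩
  | q K => exact apart_input hn hg' ⟨K, hg, Or.inr rfl⟩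
  | s K L => exact apart_of_ne trivial hg' h
  | c K L => exact apart_of_ne trivial hg' h

theorem reach_tile (hn : 1 ≤ n) (hb : b = 2 ^ t) (hκ : b * b ≤ κ * B) (hM : 16 * (b * b) ≤ M)
    {I J : ℕ} (hIJ : I ≤ J) (hJ : J ≤ n / b) :
    Reach (bstCDAG (combTrees n)) M B (tileLayout n b)
      ⟨∅, savedBefore n b I J, doneBefore b I J⟩
      ⟨∅, savedBefore n b I (J + 1), doneBefore b I (J + 1)⟩ ((2 * (n / b) + 7) * κ) := by
  have hb0 : 0 < b := hb ▸ Nat.two_pow_pos t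
  have r1 := reach_tile_cum (n := n) (I := I) (J := J) (S := savedBefore n b I J)
    (D := doneBefore b I J) hb0 hκ hM hJ hJ
    (fun h => ⟨Or.inr ⟨rfl, by omega⟩, by omega, by omega⟩)
    (fun g hg h => apart_savedBefore hn trivial hg h)
    (fun p hp h => by
      rw [cum_mem_doneBefore] at h
      have := (mem_tilePairs hb0).1 hp
      omega)
  set D₁ := doneBefore b I J ∪ {v | ∃ p ∈ tilePairs n b I J, v = .cum (p.1 + 1) p.2} with hD₁
  have hagg : ∀ p ∈ tilePairs n b I J, ∀ t, .agg (p.1 + 1) p.2 t ∉ D₁ := by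
    rintro p hp t (h | ⟨p', hp', h⟩)
    · rw [agg_mem_doneBefore] at h
      have := (mem_tilePairs hb0).1 hp
      omega
    · simp at h
  have r2 := reach_tile_middle (n := n) (I := I) (J := J)
    (S := insert (.c I J) (savedBefore n b I J)) (D := D₁) hb hκ hM
    (fun K h1 h2 => ⟨Or.inr ⟨Or.inr ⟨rfl, h2⟩, by omega, by omega⟩,
      Or.inr ⟨Or.inl h1, by omega, by omega⟩⟩) hagg _ List.prefix_rfl
  have r3 := reach_tile_final (n := n) (I := I) (J := J)
    (S := insert (.c I J) (savedBefore n b I J))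
    (D := D₁ ∪ splitsValues (fun _ => blockList b (splitOrder I J)) (tilePairs n b I J)) hb hκ hM
    (fun h => ⟨Or.inr ⟨Or.inr ⟨rfl, h⟩, by omega, by omega⟩,
      Or.inr ⟨Or.inl h, by omega, by omega⟩⟩)
    (by
      rintro g (rfl | hg) h
      · exact apart_of_ne trivial trivial h
      · exact apart_savedBefore hn trivial hg h)
    (by
      rintro p hp t (h | h)
      · exact absurd h (hagg p hp t)
      · exact (mem_splitsValues_agg h).2)
  have hsplits : ∀ f : ℕ × ℕ → List ℕ, splitsValues f (tilePairs n b I J) ⊆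
      doneBefore b I (J + 1) := by
    rintro f v ⟨p, hp, t, rfl, _⟩
    rw [agg_mem_doneBefore]
    have := (mem_tilePairs hb0).1 hp
    omega
  refine (((r1.trans r2).trans r3).weaken ?_ ?_).mono ?_
  -- The only new tile is (I, J), whose values of C and S have both been stored.
  · have key : ∀ I' J', TileBefore n b I (J + 1) I' J' →
        TileBefore n b I J I' J' ∨ I' = I ∧ J' = J := by
      rintro I' J' ⟨h1, h2, h3⟩
      by_cases h : I' = I ∧ J' = J
      · exact Or.inr h
      · exact Or.inl ⟨by omega, h2, h3⟩
    intro g hg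
    cases g with
    | p K => exact Or.inr (Or.inr hg)
    | q K => exact Or.inr (Or.inr hg)
    | s K L =>
      rcases key _ _ hg with h | ⟨rfl, rfl⟩
      · exact Or.inr (Or.inr h)
      · exact Or.inl rfl
    | c K L =>
      rcases key _ _ hg with h | ⟨rfl, rfl⟩
      · exact Or.inr (Or.inr h)
      · exact Or.inr (Or.inl rfl)
  · rintro v (((⟨a, j, h, h'⟩ | ⟨p, hp, rfl⟩) | h) | h)
    · exact ⟨a, j, by omega, h'⟩
    · rw [cum_mem_doneBefore]
      have := (mem_tilePairs hb0).1 hp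
      omega
    · exact hsplits _ h
    · exact hsplits _ h
  · have h1 : (splitOrder I J).length ≤ n / b := (length_splitOrder_le I J).trans hJ
    calc 4 * κ + 2 * κ * (splitOrder I J).length + 3 * κ
        = (2 * (splitOrder I J).length + 7) * κ := by ring
      _ ≤ _ := by gcongr

theorem reach_tile_row (hn : 1 ≤ n) (hb : b = 2 ^ t) (hκ : b * b ≤ κ * B)
    (hM : 16 * (b * b) ≤ M) (I m : ℕ) (hm : I + m ≤ n / b + 1) :
    Reach (bstCDAG (combTrees n)) M B (tileLayout n b)
      ⟨∅, savedBefore n b I I, doneBefore b I I⟩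
      ⟨∅, savedBefore n b I (I + m), doneBefore b I (I + m)⟩
      (m * ((2 * (n / b) + 7) * κ)) := by
  induction m with
  | zero => exact (Reach.refl _).mono (Nat.zero_le _)
  | succ m ih =>
    rw [add_mul, one_mul]
    exact (ih (by omega)).trans (reach_tile hn hb hκ hM (by omega) (by omega))

theorem reach_tiles (hn : 1 ≤ n) (hb : b = 2 ^ t) (hκ : b * b ≤ κ * B)
    (hM : 16 * (b * b) ≤ M) (m : ℕ) (hm : m ≤ n / b) :
    Reach (bstCDAG (combTrees n)) M B (tileLayout n b)
      ⟨∅, savedBefore n b (n / b) (n / b), doneBefore b (n / b) (n / b)⟩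
      ⟨∅, savedBefore n b (n / b - m) (n / b + 1), doneBefore b (n / b - m) (n / b + 1)⟩
      ((m + 1) * ((n / b + 1) * ((2 * (n / b) + 7) * κ))) := by
  induction m with
  | zero =>
    refine (reach_tile_row hn hb hκ hM (n / b) 1 le_rfl).mono ?_
    rw [zero_add, one_mul, one_mul]
    exact Nat.le_mul_of_pos_left _ (by omega)
  | succ m ih =>
    have r := reach_tile_row hn hb hκ hM (n / b - (m + 1)) (m + 2) (by omega)
    rw [show n / b - (m + 1) + (m + 2) = n / b + 1 by omega] at r
    -- The end of row I + 1 is the start of row I, which begins at its diagonal tile.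
    have r0 := (ih (by omega)).weaken
      (S' := savedBefore n b (n / b - (m + 1)) (n / b - (m + 1)))
      (D' := doneBefore b (n / b - (m + 1)) (n / b - (m + 1))) (by
        have key : ∀ I' J', TileBefore n b (n / b - (m + 1)) (n / b - (m + 1)) I' J' →
            TileBefore n b (n / b - m) (n / b + 1) I' J' := by
          rintro I' J' ⟨h1, h2, h3⟩
          exact ⟨by omega, h2, h3⟩
        intro g hg
        cases g with
        | p K => exact hg
        | q K => exact hg
        | s K L => exact key _ _ hg
        | c K L => exact key _ _ hg) (by
        rintro v ⟨a, j, h, h'⟩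
        exact ⟨a, j, by omega, h'⟩)
    refine (r0.trans r).mono ?_
    refine (Nat.add_le_add_left (Nat.mul_le_mul_right _ (?_ : m + 2 ≤ n / b + 1)) _).trans_eq
      (Nat.succ_mul (m + 1) _).symm
    omega

end Schedule

/-! ### The output and the cost of the blocked schedule -/

theorem AggTree.eq_or_exists_node {t T : AggTree} (h : t.IsSubtree T) :
    t = T ∨ ∃ l r, (AggTree.node l r).IsSubtree T ∧ (t = l ∨ t = r) := by
  induction T with
  | leaf k => exact Or.inl h
  | node a b iha ihb =>
    rcases h with h | h | h
    · exact Or.inl h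
    · rcases iha h with rfl | ⟨l, r, h1, h2⟩
      · exact Or.inr ⟨t, b, isSubtree_refl _, Or.inl rfl⟩
      · exact Or.inr ⟨l, r, Or.inr (Or.inl h1), h2⟩
    · rcases ihb h with rfl | ⟨l, r, h1, h2⟩
      · exact Or.inr ⟨a, t, isSubtree_refl _, Or.inr rfl⟩
      · exact Or.inr ⟨l, r, Or.inr (Or.inr h1), h2⟩

/-- Everything else has a successor: inputs enter some C, C(i, j) enters the split i of (i, j), a
proper subtree enters its parent, and S(i, j) enters S(i, j + 1) or S(i - 1, j). -/
theorem eq_root_of_mem_outputs {n : ℕ} (hn : 2 ≤ n) (T : AggTrees n) {v : BSTVertex}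
    (hv : v ∈ (bstCDAG T).outputs) : v = .agg 1 n (T.tree 1 n) := by
  obtain ⟨hv, ho⟩ := hv
  change IsBSTVertex T v at hv
  have ho' : ∀ w, IsBSTVertex T w → v ∉ bstPre T w := ho
  match v with
  | .p l =>
    obtain ⟨h1, h2⟩ := hv
    exact absurd (by simp [bstPre]) (ho' (.cum l (l + 1)) ⟨h1, by omega, by omega⟩)
  | .q l =>
    obtain ⟨h1, h2⟩ := hv
    rcases eq_or_lt_of_le h2 with rfl | h2
    · exact absurd (by simp [bstPre]) (ho' (.cum (l - 1) l) ⟨by omega, by omega, by omega⟩)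
    · exact absurd (by simp [bstPre, cumVertex]) (ho' (.cum l (l + 1)) ⟨h1, by omega, by omega⟩)
  | .cum i j =>
    obtain ⟨h1, h2, h3⟩ := hv
    exact absurd (by simp [bstPre, cumVertex, h2.ne])
      (ho' _ (isBSTVertex_leaf T h1 le_rfl h2 h3))
  | .agg i j t =>
    obtain ⟨h1, h2, h3, h4⟩ := hv
    rcases AggTree.eq_or_exists_node h4 with rfl | ⟨l, r, h5, h6⟩
    · by_cases hi : i = 1
      · by_cases hj : j = n
        · rw [hi, hj]
        · exact absurd (by simp [bstPre, rootVertex, h2.ne])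
            (ho' _ (isBSTVertex_leaf T (i := i) (k := j) (j := j + 1) h1 h2.le (by omega)
              (by omega)))
      · have : i - 1 + 1 = i := by omega
        exact absurd (by simp [bstPre, rootVertex, h2.ne, this])
          (ho' _ (isBSTVertex_leaf T (i := i - 1) (k := i - 1) (j := j) (by omega) le_rfl
            (by omega) h3))
    · refine absurd ?_ (ho' (.agg i j (.node l r)) ⟨h1, h2, h3, h5⟩)
      rcases h6 with rfl | rfl <;> simp [bstPre]

theorem bstIO_le_of_block {n b t M B κ : ℕ} (hn : 2 ≤ n) (hb : b = 2 ^ t)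
    (hκ : b * b ≤ κ * B) (hM : 16 * (b * b) ≤ M) :
    bstIO (combTrees n) M B ≤
      (((n / b + 1) * ((n / b + 1) * ((2 * (n / b) + 7) * κ)) : ℕ) : ℕ∞) := by
  have hb0 : 0 < b := hb ▸ Nat.two_pow_pos t
  have r := reach_tiles (n := n) (by omega) hb hκ hM (n / b) le_rfl
  rw [Nat.sub_self] at r
  have r0 : Reach (bstCDAG (combTrees n)) M B (tileLayout n b)
      ⟨∅, {g | (∃ J, g = .p J) ∨ ∃ J, g = .q J}, ∅⟩
      ⟨∅, savedBefore n b (n / b) (n / b), doneBefore b (n / b) (n / b)⟩ 0 := by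
    refine Reach.discard subset_rfl ?_ (Set.empty_subset _) (by simp)
    intro g hg
    have key : ∀ I' J', ¬ TileBefore n b (n / b) (n / b) I' J' := by
      rintro I' J' ⟨h1, h2, h3⟩
      omega
    cases g with
    | p K => exact Or.inl ⟨K, rfl⟩
    | q K => exact Or.inr ⟨K, rfl⟩
    | s K L => exact absurd hg (key _ _)
    | c K L => exact absurd hg (key _ _)
  refine ((r0.trans r).mono (by rw [zero_add])).ioComplexityNR_le
    (fun g hg => holds_input g hg) fun v hv => ?_
  rw [eq_root_of_mem_outputs hn _ hv]
  have h1 := s_mem_items (n := n) (a := 0) (j := n) hb0 (Nat.zero_div b) rfl (by omega) le_rfl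
  rw [sVertex_eq_agg (by omega)] at h1
  exact ⟨.s 0 (n / b), ⟨Or.inr ⟨rfl, by omega⟩, Nat.zero_le _, le_rfl⟩, h1⟩

/-! ### The schedule for small caches -/

section Naive

variable {V : Type} [DecidableEq V] {G : CDAG V} {M B : ℕ} {Λ : Layout V V}

theorem reach_load_all (hΛ : ∀ v, Λ.items v = [v]) (hB : 1 ≤ B) {S D : Set V} (A : Finset V)
    (hA : ∀ u ∈ A, u ∈ S) (hM : A.card ≤ M) :
    Reach G M B Λ ⟨∅, S, D⟩ ⟨A, S, D⟩ A.card := by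
  induction A using Finset.induction_on with
  | empty => exact (Reach.refl _).mono (Nat.zero_le _)
  | insert u A hu ih =>
    have he : insert u A = A ∪ (Λ.items u).toFinset := by
      ext x
      simp [hΛ]
    rw [Finset.card_insert_of_notMem hu] at hM ⊢
    refine (ih (fun v hv => hA v (Finset.mem_insert_of_mem hv)) (by omega)).trans ?_
    rw [he]
    refine Reach.load (hA u (Finset.mem_insert_self _ _)) (by simpa [hΛ] using hB) ?_
    rw [← he, Finset.card_insert_of_notMem hu]
    exact hM

/-- Remove a vertex of maximal rank and evaluate it last: at most three reads, a computation and one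
write, with four words of cache. -/
theorem reach_one_by_one {R : Type} [LinearOrder R] (rank : V → R)
    (hΛ : ∀ v, Λ.items v = [v]) (hB : 1 ≤ B) (hM : 4 ≤ M) {S : Set V} (W : Finset V)
    (hW : ∀ v ∈ W, v ∈ G.vertices ∧ (G.pre v).Nonempty ∧ (G.pre v).card ≤ 3 ∧
      ∀ u ∈ G.pre v, (u ∈ S ∨ u ∈ W) ∧ rank u < rank v)
    (hap : ∀ v ∈ W, ∀ u, u ∈ S ∨ u ∈ W → u ≠ v → Λ.Apart u v) :
    Reach G M B Λ ⟨∅, S, ∅⟩ ⟨∅, S ∪ W, W⟩ (4 * W.card) := by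
  obtain ⟨m, hm⟩ : ∃ m, W.card = m := ⟨_, rfl⟩
  induction m generalizing W with
  | zero =>
    obtain rfl := Finset.card_eq_zero.1 hm
    exact Reach.discard subset_rfl (by simp) (Set.empty_subset _) (by simp)
  | succ m ih =>
    obtain ⟨v, hv, hmax⟩ := W.exists_max_image rank (Finset.card_pos.1 (by omega))
    obtain ⟨h1, h2, h3, h4⟩ := hW v hv
    have hcard : (W.erase v).card = m := by
      rw [Finset.card_erase_of_mem hv, hm]
      rfl
    have hpre : ∀ w ∈ W, ∀ u ∈ G.pre w, u ∈ S ∨ u ∈ W.erase v := fun w hw u hu => by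
      obtain ⟨h5, h6⟩ := (hW w hw).2.2.2 u hu
      refine h5.imp id fun h => Finset.mem_erase.2 ⟨?_, h⟩
      rintro rfl
      exact absurd (hmax w hw) (not_le.2 h6)
    have r0 := ih (W.erase v)
      (fun w hw => by
        have hw' := Finset.mem_of_mem_erase hw
        obtain ⟨a1, a2, a3, a4⟩ := hW w hw'
        exact ⟨a1, a2, a3, fun u hu => ⟨hpre w hw' u hu, (a4 u hu).2⟩⟩)
      (fun w hw u hu hne => hap w (Finset.mem_of_mem_erase hw) u
        (hu.imp id Finset.mem_of_mem_erase) hne) hcard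
    have r1 := reach_load_all (G := G) (M := M) (D := ((W.erase v : Finset V) : Set V)) hΛ hB
      (G.pre v) (S := S ∪ (W.erase v : Finset V)) (fun u hu => hpre v hv u hu) (by omega)
    have hins : (insert v (G.pre v)).card ≤ M := (Finset.card_insert_le _ _).trans (by omega)
    have r2 := Reach.compute (M := M) (B := B) (Λ := Λ) (C := G.pre v)
      (S := S ∪ (W.erase v : Finset V)) (D := ((W.erase v : Finset V) : Set V)) h1 h2 subset_rfl
      (by simp) hins
    have r3 := Reach.save (G := G) (M := M) (B := B) (Λ := Λ) (C := insert v (G.pre v))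
      (S := S ∪ (W.erase v : Finset V)) (D := insert v ((W.erase v : Finset V) : Set V)) (g := v)
      (κ := 1) (fun u hu hne => hap v hv u (hu.imp id Finset.mem_of_mem_erase) hne)
      (by simp [hΛ]) (by simpa [hΛ] using hB) hins
    have hW' : insert v ((W.erase v : Finset V) : Set V) = W := by
      rw [← Finset.coe_insert, Finset.insert_erase hv]
    refine ((((r0.trans r1).trans r2).trans r3).trans
      (Reach.discard (Finset.empty_subset _) ?_ (subset_of_eq hW') hins)).mono (by omega)
    rw [← Set.union_insert, hW']

end Naive

open Classical in
/-- The vertices that are computed. -/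
noncomputable def computedVertices (n : ℕ) : Finset BSTVertex :=
  (((Finset.range (n + 1) ×ˢ Finset.range (n + 1)).image fun x => .cum x.1 x.2) ∪
    ((Finset.range (n + 1) ×ˢ Finset.range (n + 1) ×ˢ Finset.range (n + 1)).image
      fun x => .agg x.1 x.2.1 (.leaf x.2.2)) ∪
    ((Finset.range (n + 1) ×ˢ Finset.range (n + 1) ×ˢ Finset.range (n + 1)).image
      fun x => .agg x.1 x.2.1 (.comb ((splitOrder (x.1 - 1) x.2.1).take x.2.2)))).filter
    fun v => IsBSTVertex (combTrees n) v ∧ (bstPre (combTrees n) v).Nonempty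

theorem card_computedVertices_le (n : ℕ) : (computedVertices n).card ≤ 3 * (n + 1) ^ 3 := by
  classical
  refine (Finset.card_filter_le _ _).trans ((Finset.card_union_le _ _).trans ?_)
  have h1 := Finset.card_union_le
    ((Finset.range (n + 1) ×ˢ Finset.range (n + 1)).image fun x => BSTVertex.cum x.1 x.2)
    ((Finset.range (n + 1) ×ˢ Finset.range (n + 1) ×ˢ Finset.range (n + 1)).image
      fun x => BSTVertex.agg x.1 x.2.1 (.leaf x.2.2))
  have h2 := Finset.card_image_le (s := Finset.range (n + 1) ×ˢ Finset.range (n + 1))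
    (f := fun x => BSTVertex.cum x.1 x.2)
  have h3 := Finset.card_image_le
    (s := Finset.range (n + 1) ×ˢ Finset.range (n + 1) ×ˢ Finset.range (n + 1))
    (f := fun x => BSTVertex.agg x.1 x.2.1 (.leaf x.2.2))
  have h4 := Finset.card_image_le
    (s := Finset.range (n + 1) ×ˢ Finset.range (n + 1) ×ˢ Finset.range (n + 1))
    (f := fun x => BSTVertex.agg x.1 x.2.1 (.comb ((splitOrder (x.1 - 1) x.2.1).take x.2.2)))
  simp only [Finset.card_product, Finset.card_range] at h2 h3 h4
  have h5 : (n + 1) * (n + 1) ≤ (n + 1) * ((n + 1) * (n + 1)) :=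
    Nat.le_mul_of_pos_left _ (by omega)
  have h6 : (n + 1) ^ 3 = (n + 1) * ((n + 1) * (n + 1)) := by ring
  omega

theorem mem_computedVertices {n : ℕ} {v : BSTVertex} : v ∈ computedVertices n ↔
    IsBSTVertex (combTrees n) v ∧ (bstPre (combTrees n) v).Nonempty := by
  classical
  rw [computedVertices, Finset.mem_filter]
  refine ⟨And.right, fun h => ⟨?_, h⟩⟩
  simp only [Finset.mem_union, Finset.mem_image, Finset.mem_product, Finset.mem_range]
  match v with
  | .p l => simp [bstPre] at h
  | .q l => simp [bstPre] at h
  | .cum i j =>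
    obtain ⟨h1, h2, h3⟩ := h.1
    exact Or.inl (Or.inl ⟨(i, j), ⟨by simp only; omega, by simp only; omega⟩, rfl⟩)
  | .agg i j t =>
    obtain ⟨h1, h2, h3, h4⟩ := h.1
    have hm : i ∈ splitOrder (i - 1) j := by rw [mem_splitOrder]; omega
    rcases (AggTree.isSubtree_comb_iff (List.ne_nil_of_mem hm)).1 h4 with
      ⟨k, hk, rfl⟩ | ⟨l, hl, _, rfl⟩
    · rw [mem_splitOrder] at hk
      exact Or.inl (Or.inr ⟨(i, j, k), ⟨by simp only; omega, by simp only; omega,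
        by simp only; omega⟩, rfl⟩)
    · have h5 := hl.length_le.trans (length_splitOrder_le (i - 1) j)
      refine Or.inr ⟨(i, j, l.length), ⟨by simp only; omega, by simp only; omega,
        by simp only; omega⟩, ?_⟩
      simp only
      rw [← List.prefix_iff_eq_take.1 hl]

theorem bstIO_le_naive {n M B : ℕ} (hn : 2 ≤ n) (hB : 1 ≤ B) (hM : 4 ≤ M) :
    bstIO (combTrees n) M B ≤ ((12 * (n + 1) ^ 3 : ℕ) : ℕ∞) := by
  -- Any injective numbering gives each computed value its own cell beyond the inputs.
  obtain ⟨f, hf⟩ := Set.countable_iff_exists_injOn.1 (computedVertices n).finite_toSet.countable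
  set Λ : Layout BSTVertex BSTVertex :=
    ⟨fun v => match v with
      | .p l => l - 1
      | .q l => n - 1 + (l - 1)
      | v => 2 * n + f v, fun v => [v]⟩ with hΛ
  set S : Set BSTVertex :=
    {v | (∃ l, 1 ≤ l ∧ l < n ∧ v = .p l) ∨ ∃ l, 1 ≤ l ∧ l ≤ n ∧ v = .q l} with hS
  have hbase : ∀ v, (bstPre (combTrees n) v).Nonempty → Λ.base v = 2 * n + f v := by
    intro v hv
    cases v <;> simp [bstPre] at hv <;> rfl
  have hmem : ∀ v, IsBSTVertex (combTrees n) v → v ∈ S ∨ v ∈ computedVertices n := by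
    intro v hv
    rw [mem_computedVertices]
    match v with
    | .p l => exact Or.inl (Or.inl ⟨l, hv.1, hv.2, rfl⟩)
    | .q l => exact Or.inl (Or.inr ⟨l, hv.1, hv.2, rfl⟩)
    | .cum i j => exact Or.inr ⟨hv, by simp [bstPre]⟩
    | .agg i j (.leaf k) => exact Or.inr ⟨hv, by simp [bstPre]⟩
    | .agg i j (.node l r) => exact Or.inr ⟨hv, by simp [bstPre]⟩
  have r := reach_one_by_one (G := bstCDAG (combTrees n)) (M := M) (B := B) (Λ := Λ) bstRank
    (fun _ => rfl) hB hM (S := S) (computedVertices n)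
    (fun v hv => by
      obtain ⟨h1, h2⟩ := mem_computedVertices.1 hv
      refine ⟨h1, h2, ?_, fun u hu => ⟨hmem u (bstPre_mem _ v h1 u hu), bstRank_lt _ v h1 u hu⟩⟩
      change (bstPre (combTrees n) v).card ≤ 3
      match v with
      | .p l => simp [bstPre]
      | .q l => simp [bstPre]
      | .cum i j => exact Finset.card_le_three
      | .agg i j (.leaf k) => exact Finset.card_le_three
      | .agg i j (.node l r) => exact Finset.card_le_two.trans (by norm_num))
    (fun v hv u hu hne => by
      have hv' := hbase v (mem_computedVertices.1 hv).2
      change Λ.base u + 1 ≤ Λ.base v ∨ Λ.base v + 1 ≤ Λ.base u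
      rw [hv']
      rcases hu with (⟨l, h1, h2, rfl⟩ | ⟨l, h1, h2, rfl⟩) | hu
      · left
        change l - 1 + 1 ≤ _
        omega
      · left
        change n - 1 + (l - 1) + 1 ≤ _
        omega
      · rw [hbase u (mem_computedVertices.1 hu).2]
        have : f u ≠ f v := fun h => hne (hf hu hv h)
        omega)
  refine (r.mono (w' := 12 * (n + 1) ^ 3) ?_).ioComplexityNR_le (fun g hg => ?_) fun v hv => ?_
  · have := card_computedVertices_le n
    omega
  · intro k hk
    obtain rfl : k = 0 := by
      change k < 1 at hk
      omega
    rcases hg with ⟨l, h1, h2, rfl⟩ | ⟨l, h1, h2, rfl⟩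
    · change bstInput n (l - 1 + 0) = some (.p l)
      rw [bstInput, if_pos (by omega)]
      congr 2
      omega
    · change bstInput n (n - 1 + (l - 1) + 0) = some (.q l)
      rw [bstInput, if_neg (by omega), if_pos (by omega)]
      congr 2
      omega
  · exact ⟨v, hmem v hv.1, List.mem_singleton.2 rfl⟩

/-! ### The upper bound: choice of the tile size -/

theorem upper_bound {n M B : ℕ} (hB : 1 ≤ B) (hBM : B ≤ M) (hM : 4 ≤ M)
    (hn : (M : ℝ) < 1 / 10000 * (n : ℝ) ^ 2) :
    (bstIO (combTrees n) M B : ℝ≥0∞) ≤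
      ENNReal.ofReal (40000 * ((n : ℝ) ^ 3 / ((B : ℝ) * √(M : ℝ)))) := by
  have hn1 : M < n ^ 2 := by
    have : (M : ℝ) < (n : ℝ) ^ 2 := by nlinarith [sq_nonneg (n : ℝ)]
    exact_mod_cast this
  have hn2 : 2 ≤ n := by nlinarith
  have hMr : (0 : ℝ) < M := by exact_mod_cast (by omega : 0 < M)
  have hBr : (0 : ℝ) < B := by exact_mod_cast hB
  have hBMr : (B : ℝ) ≤ M := by exact_mod_cast hBM
  have hs : 0 < √(M : ℝ) := Real.sqrt_pos.2 hMr
  have key : ∀ w : ℕ, bstIO (combTrees n) M B ≤ (w : ℕ∞) →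
      (w : ℝ) ≤ 40000 * ((n : ℝ) ^ 3 / ((B : ℝ) * √(M : ℝ))) →
      (bstIO (combTrees n) M B : ℝ≥0∞) ≤
        ENNReal.ofReal (40000 * ((n : ℝ) ^ 3 / ((B : ℝ) * √(M : ℝ)))) := by
    intro w h1 h2
    refine (ENat.toENNReal_le.2 h1).trans ?_
    rw [ENat.toENNReal_coe, ← ENNReal.ofReal_natCast]
    exact ENNReal.ofReal_le_ofReal h2
  -- Below 16 no tile fits. There `B ≤ M` gives B·√M ≤ 64, so O(n³) operations suffice.
  rcases lt_or_ge M 16 with hM16 | hM16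
  · refine key _ (bstIO_le_naive hn2 hB hM) ?_
    have h1 : √(M : ℝ) ≤ 4 := by
      rw [Real.sqrt_le_left (by norm_num)]
      norm_num
      exact_mod_cast hM16.le
    have h2 : (M : ℝ) ≤ 16 := by exact_mod_cast hM16.le
    have h3 : (B : ℝ) * √M ≤ 64 := by nlinarith
    have h4 : ((n : ℝ) + 1) ^ 3 ≤ (2 * n) ^ 3 := by
      have : (2 : ℝ) ≤ n := by exact_mod_cast hn2
      gcongr
      linarith
    push_cast
    rw [← mul_div_assoc, le_div_iff₀ (by positivity)]
    calc 12 * ((n : ℝ) + 1) ^ 3 * (B * √M) ≤ 12 * (2 * n) ^ 3 * 64 := by gcongr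
      _ ≤ 40000 * (n : ℝ) ^ 3 := by nlinarith [pow_nonneg (Nat.cast_nonneg (α := ℝ) n) 3]
  -- The largest power of two b with 16b² ≤ M; thus M < 64b² and √M ≤ 8b.
  · set t := Nat.log 4 (M / 16) with ht
    set b := 2 ^ t with hb
    have hb0 : 0 < b := Nat.two_pow_pos t
    have hbb : b * b = 4 ^ t := by rw [hb, ← mul_pow]; rfl
    have h1 : 4 ^ t ≤ M / 16 := Nat.pow_log_le_self 4 (by omega)
    have h2 : M / 16 < 4 ^ (t + 1) := Nat.lt_pow_succ_log_self (by norm_num) _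
    have h3 : 16 * (b * b) ≤ M := by omega
    have h4 : M < 64 * (b * b) := by rw [pow_succ] at h2; omega
    have hbn : b ≤ n := by
      by_contra! h
      have : n ^ 2 ≤ b ^ 2 := Nat.pow_le_pow_left h.le 2
      nlinarith
    set κ := b * b / B + 1 with hκ
    have h5 : b * b ≤ κ * B := (Nat.lt_div_mul_add (a := b * b) (b := B) hB).le.trans
      (by rw [hκ, add_mul, one_mul])
    refine key _ (bstIO_le_of_block hn2 hb h5 h3) ?_
    set N := n / b with hN
    have hN1 : 1 ≤ N := Nat.div_pos hbn hb0
    have h6 : (N + 1) * ((N + 1) * ((2 * N + 7) * κ)) ≤ 36 * N ^ 3 * κ := by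
      calc (N + 1) * ((N + 1) * ((2 * N + 7) * κ))
          ≤ (2 * N) * ((2 * N) * ((9 * N) * κ)) := by gcongr <;> omega
        _ = 36 * N ^ 3 * κ := by ring
    have hb0r : (0 : ℝ) < b := by exact_mod_cast hb0
    have h7 : (N : ℝ) * b ≤ n := by exact_mod_cast Nat.div_mul_le_self n b
    have h8 : √(M : ℝ) ≤ 8 * b := by
      rw [Real.sqrt_le_left (by positivity)]
      have : (M : ℝ) ≤ 64 * (b * b) := by exact_mod_cast h4.le
      nlinarith
    have h9 : (N : ℝ) * √M ≤ 8 * n := by nlinarith [Nat.cast_nonneg (α := ℝ) N]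
    -- Rounding up to whole transfers costs at most B words, absorbed by `B ≤ M`.
    have h10 : (κ : ℝ) * B ≤ 2 * M := by
      have : κ * B ≤ b * b + B := by
        rw [hκ, add_mul, one_mul]
        have := Nat.div_mul_le_self (b * b) B
        omega
      have : κ * B ≤ 2 * M := by omega
      exact_mod_cast this
    have h11 : ((N : ℝ) * √M) ^ 3 ≤ (8 * n) ^ 3 := by gcongr
    have h12 : √(M : ℝ) ^ 2 = M := Real.sq_sqrt hMr.le
    have h13 : (((N + 1) * ((N + 1) * ((2 * N + 7) * κ)) : ℕ) : ℝ) ≤ 36 * (N : ℝ) ^ 3 * κ := by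
      exact_mod_cast h6
    refine h13.trans ?_
    rw [← mul_div_assoc, le_div_iff₀ (by positivity)]
    calc 36 * (N : ℝ) ^ 3 * κ * (B * √M) = 36 * N ^ 3 * √M * (κ * B) := by ring
      _ ≤ 36 * N ^ 3 * √M * (2 * M) := by gcongr
      _ = 72 * (N ^ 3 * √M * √M ^ 2) := by rw [h12]; ring
      _ = 72 * (N * √M) ^ 3 := by ring
      _ ≤ 72 * (8 * n) ^ 3 := by gcongr
      _ ≤ 40000 * (n : ℝ) ^ 3 := by nlinarith [pow_nonneg (Nat.cast_nonneg (α := ℝ) n) 3]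

theorem mainTheorem7 :
    ∃ c c₁ c₂ : ℝ, 0 < c ∧ 0 < c₁ ∧ 0 < c₂ ∧
      (∀ (n M B : ℕ) (T : AggTrees n), 1 ≤ B → 4 ≤ M → (M : ℝ) < c * (n : ℝ) ^ 2 →
        ENNReal.ofReal (c₁ * ((n : ℝ) ^ 3 / ((B : ℝ) * √(M : ℝ)))) ≤ (bstIO T M B : ℝ≥0∞)) ∧
      (∃ T : (n : ℕ) → AggTrees n, ∀ n M B : ℕ,
        1 ≤ B → B ≤ M → 4 ≤ M → (M : ℝ) < c * (n : ℝ) ^ 2 →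
        (bstIO (T n) M B : ℝ≥0∞) ≤
          ENNReal.ofReal (c₂ * ((n : ℝ) ^ 3 / ((B : ℝ) * √(M : ℝ))))) :=
  ⟨1 / 10000, 1 / 10000, 40000, by norm_num, by norm_num, by norm_num,
    fun _ _ _ T hB hM hn => lower_bound T hB hM hn,
    combTrees, fun _ _ _ hB hBM hM hn => upper_bound hB hBM hM hn⟩
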